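/- Let $\lambda_0,\dots,\lambda_9\in\mathbb C$, $f(x)=\sum_{k=0}^{9}\lambda_kx^k$, and consider the curve $y^2=f(x)$ (of genus four when $\lambda_9\ne0$ and $f$ has distinct roots; this is not needed). Let $U\subseteq\mathbb C^4$ be open, with coordinates $u=(u_1,\dots,u_4)$, and let $x_i(u),y_i(u)$ ($1\le i\le4$) be holomorphic on $U$ with $y_i^2=f(x_i)$, $y_i\neq0$, the $x_i$ pairwise distinct, solving Jacobi's inversion problem $$du_k=\sum_{i=1}^4\frac{x_i^{k-1}\,dx_i}{y_i},\qquad 1\le k\le4 .$$ Put $F(t)=\prod_{m=1}^4(t-x_m)$ and $\lambda_{10}=0$. For $1\le j\le 4$ let $h_a^{(i)}$ be the $a$-th elementary symmetric function of the three $x_m$ with $m\ne i$, let $\chi_{3-j}^{(i)}=\sum_{a=0}^{3-j}(-1)^ah^{(i)}_a x_i^{3-j-a}$ (which is $0$ for $j=4$), and define the 1-form $$d(-\zeta_j)=\frac14\sum_{i=1}^4\frac{dx_i}{y_i}\sum_{k=j}^{9-j}(k+1-j)\lambda_{k+1+j}x_i^k-\frac12\,d\Big(\sum_{i=1}^4\frac{y_i\,\chi^{(i)}_{3-j}}{F'(x_i)}\Big),\qquad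 \wp_{jk}=\frac{\partial(-\zeta_j)}{\partial u_k},\qquad \wp_{ijkl}=\frac{\partial^2\wp_{ij}}{\partial u_k\,\partial u_l},$$ that is, $\wp_{jk}$ is the coefficient of $du_k$ in the form $d(-\zeta_j)$. Then $\wp_{jk}=\wp_{kj}$ on $U$ for $1\le j,k\le4$, and with $$\begin{aligned} \Delta_2&=-\wp_{44}\wp_{22}+\wp_{42}^2+\wp_{44}\wp_{31}-\wp_{43}\wp_{41}+\wp_{43}\wp_{32}-\wp_{42}\wp_{33},\\ \Delta_3&=\wp_{44}\wp_{21}-\wp_{42}\wp_{41}-\wp_{43}\wp_{31}+\wp_{41}\wp_{33},\\ \Delta_4&=\wp_{44}\wp_{11}-\wp_{41}^2-\wp_{42}\wp_{31}+\wp_{41}\wp_{32},\\ \Delta_5&=\wp_{43}\wp_{11}-\wp_{41}\wp_{31}-\wp_{42}\wp_{21}+\wp_{41}\wp_{22},\\ \Delta_7&=-\wp_{33}\wp_{11}+\wp_{31}^2+\wp_{42}\wp_{11}-\wp_{41}\wp_{21}+\wp_{32}\wp_{21}-\wp_{31}\wp_{22}, \end{aligned}$$ the following 35 equations hold on $U$: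 $$\begin{aligned} (1)\quad & \wp_{4444}-6\wp_{44}^2=\lambda_9 \wp_{43} +\lambda_8 \wp_{44} +\frac{1}{8} \lambda_7 \lambda_9 \\ (2)\quad & \wp_{4443}-6\wp_{44} \wp_{43}=\frac{3}{2} \lambda_9 \wp_{42} -\frac{1}{2}\lambda_9 \wp_{33}+\lambda_8 \wp_{43} \\ (3)\quad & \wp_{4442}-6\wp_{44} \wp_{42}=\frac{3}{2} \lambda_9 \wp_{41} -\frac{1}{2}\lambda_9 \wp_{32}+\lambda_8 \wp_{42} \\ (4)\quad & \wp_{4441}-6\wp_{44} \wp_{41}=-\frac{1}{2} \lambda_9 \wp_{31} +\lambda_8 \wp_{41} \\ (5)\quad & \wp_{4433}-4\wp_{43}^2-2\wp_{44} \wp_{33} =\frac{3}{2} \lambda_9 \wp_{41}-\frac{1}{2}\lambda_9\wp_{32} +\lambda_8 \wp_{42} +\frac{1}{2} \lambda_7 \wp_{43} \\ (6)\quad & \wp_{4432}-4\wp_{43}\wp_{42}-2\wp_{44} \wp_{32} =-\frac{1}{2} \lambda_9 \wp_{31}+\lambda_8\wp_{41} +\frac{1}{2}\lambda_7\wp_{42}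 \\ (7)\quad & \wp_{4431}-4\wp_{43}\wp_{41}-2\wp_{44} \wp_{31} =\frac{1}{2} \lambda_7 \wp_{41} \\ (8)\quad & \wp_{4422}-4\wp_{42}^2-2\wp_{44} \wp_{22} =2 \Delta_2+\frac{1}{2} \lambda_7 \wp_{41} \\ (9)\quad & \wp_{4421}-4\wp_{42}\wp_{41}-2\wp_{44} \wp_{21} =-2 \Delta_3 \\ (10)\quad & \wp_{4411}-4\wp_{41}^2-2\wp_{44} \wp_{11} =-2 \Delta_4 \\ (11)\quad & \wp_{4333}-6\wp_{43}\wp_{33} =\frac{3}{2} \lambda_9 \wp_{31}-\frac{3}{2} \lambda_9 \wp_{22}+\lambda_8 \wp_{41} +\lambda_7 \wp_{42} +\lambda_6 \wp_{43}-\frac{1}{2} \lambda_5 \wp_{44} -\frac{1}{4} \lambda_4 \lambda_9 \\ (12)\quad & \wp_{4332}-4\wp_{43}\wp_{32}-2\wp_{42}\wp_{33} =-2 \Delta_2 -\lambda_9 \wp_{21}+\lambda_7 \wp_{41} +\lambda_6 \wp_{42} -\frac{1}{8} \lambda_3 \lambda_9 \\ (13)\quad & \wp_{4331}-4\wp_{43}\wp_{31}-2\wp_{41}\wp_{33}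 =2 \Delta_3 +\frac{1}{2}\lambda_9 \wp_{11}+\lambda_6 \wp_{41} \\ (14)\quad & \wp_{4322}-4\wp_{42}\wp_{32}-2\wp_{43}\wp_{22} =2 \Delta_3 -\lambda_9 \wp_{11}+\lambda_6 \wp_{41} +\frac{1}{2}\lambda_5 \wp_{42}-\frac{1}{4} \lambda_2 \lambda_9 \\ (15)\quad & \wp_{4321}-2\wp_{43}\wp_{21}-2\wp_{42}\wp_{31} -2\wp_{41}\wp_{32}=\frac{1}{2}\lambda_5 \wp_{41} -\frac{1}{8} \lambda_1 \lambda_9 \\ (16)\quad & \wp_{4311}-4\wp_{41}\wp_{31}-2\wp_{43}\wp_{11} =-2 \Delta_5-\frac{1}{4} \lambda_0 \lambda_9 \\ (17)\quad & \wp_{4222}-6\wp_{42}\wp_{22} =6 \Delta_4 +\lambda_5 \wp_{41}+\lambda_4 \wp_{42}-\frac{1}{2}\lambda_3 \wp_{43} +\lambda_2 \wp_{44} -\frac{1}{4} \lambda_1 \lambda_9 \\ (18)\quad & \wp_{4221}-4\wp_{42}\wp_{21}-2\wp_{41}\wp_{22} =2 \Delta_5 +\lambda_4 \wp_{41}+\frac{1}{2}\lambda_1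 \wp_{44} -\frac{1}{4} \lambda_0 \lambda_9 \\ (19)\quad & \wp_{4211}-4\wp_{41}\wp_{21}-2\wp_{42}\wp_{11} = \frac{1}{2}\lambda_3 \wp_{41}+\lambda_0 \wp_{44} \\ (20)\quad & \wp_{4111}-6\wp_{41}\wp_{11} =\lambda_2 \wp_{41}-\frac{1}{2}\lambda_1 \wp_{42}+\lambda_0 \wp_{43} \\ (21)\quad & \wp_{3333}-6\wp_{33}^2=12 \Delta_2 -3\lambda_9 \wp_{21}+4 \lambda_8 \wp_{31}-3\lambda_8 \wp_{22} +\lambda_7 \wp_{32} +\lambda_6 \wp_{33}+\lambda_5 \wp_{43}-3\lambda_4 \wp_{44} +\frac{1}{8} \lambda_5 \lambda_7 -\frac{1}{2} \lambda_4 \lambda_8-\frac{3}{8} \lambda_3 \lambda_9 \\ (22)\quad & \wp_{3332}-6\wp_{33}\wp_{32}=-6 \Delta_3 -\frac{3}{2}\lambda_9 \wp_{11}-2 \lambda_8 \wp_{21}+\frac{3}{2}\lambda_7 \wp_{31} -\frac{1}{2}\lambda_7 \wp_{22}+\lambda_6 \wp_{32}+\lambda_5 \wp_{42} -\frac{3}{2}\lambda_3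 \wp_{44} -\frac{1}{2} \lambda_2 \lambda_9-\frac{1}{4} \lambda_3 \lambda_8 \\ (23)\quad & \wp_{3331}-6\wp_{33}\wp_{31}=6 \Delta_4 +\lambda_8 \wp_{11}-\frac{1}{2} \lambda_7 \wp_{21}+\lambda_6 \wp_{31} +\lambda_5 \wp_{41} -\frac{1}{4} \lambda_1 \lambda_9 \\ (24)\quad & \wp_{3322}-4\wp_{32}^2-2 \wp_{33} \wp_{22} =-6 \Delta_4-2\lambda_8 \wp_{11}-\frac{1}{2} \lambda_7 \wp_{21} +\lambda_6 \wp_{31} +\frac{1}{2}\lambda_5 \wp_{41}+\frac{1}{2}\lambda_5 \wp_{32} +\lambda_4 \wp_{42}-\frac{1}{2} \lambda_3 \wp_{43}-2\lambda_2 \wp_{44} -\frac{1}{2} \lambda_1 \lambda_9-\frac{1}{2} \lambda_2 \lambda_8 \\ (25)\quad & \wp_{3321}-4\wp_{32}\wp_{31}-2\wp_{33}\wp_{21} =2 \Delta_5 +\frac{1}{2}\lambda_5 \wp_{31}+\lambda_4 \wp_{41} -\lambda_1 \wp_{44} -\frac{1}{4} \lambda_1 \lambda_8-\frac{1}{2}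 \lambda_0 \lambda_9 \\ (26)\quad & \wp_{3311}-4\wp_{31}^2-2\wp_{33}\wp_{11} =2 \Delta_7 +\frac{1}{2}\lambda_3 \wp_{41}-2\lambda_0 \wp_{44}-\frac{1}{2} \lambda_0 \lambda_8 \\ (27)\quad & \wp_{3222}-6\wp_{32}\wp_{22} =-6 \Delta_5 -\frac{3}{2}\lambda_7 \wp_{11}+ \lambda_5 \wp_{31}+\lambda_4 \wp_{32} +\frac{3}{2}\lambda_3 \wp_{42} -\frac{1}{2}\lambda_3 \wp_{33}-2\lambda_2 \wp_{43} -\frac{3}{2} \lambda_1 \wp_{44} -\frac{3}{4} \lambda_0 \lambda_9-\frac{1}{2} \lambda_1 \lambda_8-\frac{1}{4} \lambda_2 \lambda_7 \\ (28)\quad & \wp_{3221}-4\wp_{32}\wp_{21}-2\wp_{31}\wp_{22} =-2 \Delta_7 +\lambda_4 \wp_{31}+ \lambda_3 \wp_{41} -\lambda_1 \wp_{43} -\lambda_0 \wp_{44} -\frac{1}{2} \lambda_0 \lambda_8-\frac{1}{8} \lambda_1 \lambda_7 \\ (29)\quad & \wp_{3211}-4\wp_{31}\wp_{21}-2\wp_{32}\wp_{11}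 =\frac{1}{2}\lambda_3 \wp_{31}+ \lambda_2 \wp_{41} -\frac{1}{2}\lambda_1 \wp_{42} -\lambda_0 \wp_{43}-\frac{1}{4} \lambda_0 \lambda_7 \\ (30)\quad & \wp_{3111}-6\wp_{31}\wp_{11} =\lambda_2 \wp_{31}+\frac{3}{2} \lambda_1 \wp_{41}-\frac{1}{2}\lambda_1 \wp_{32} -3\lambda_0 \wp_{42}+\lambda_0 \wp_{33} \\ (31)\quad & \wp_{2222}-6\wp_{22}^2 =12 \Delta_7 -3\lambda_6 \wp_{11}+ \lambda_5 \wp_{21}+\lambda_4 \wp_{22} +\lambda_3 \wp_{32} +4\lambda_2 \wp_{42}-3\lambda_2 \wp_{33}-3 \lambda_1 \wp_{43} -3 \lambda_0 \wp_{44}-\lambda_0 \lambda_8-\frac{3}{8} \lambda_1 \lambda_7 -\frac{1}{2} \lambda_2 \lambda_6+\frac{1}{8} \lambda_3 \lambda_5 \\ (32)\quad & \wp_{2221}-6\wp_{22}\wp_{21} =-\frac{1}{2}\lambda_5 \wp_{11}+ \lambda_4 \wp_{21}+\lambda_3 \wp_{31} +\lambda_2 \wp_{41} +\frac{3}{2}\lambda_1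 \wp_{42}-\frac{3}{2}\lambda_1 \wp_{33} -3\lambda_0 \wp_{43} -\frac{1}{2} \lambda_0 \lambda_7-\frac{1}{4} \lambda_1 \lambda_6 \\ (33)\quad & \wp_{2211}-4\wp_{21}^2-2\wp_{22}\wp_{11} =\frac{1}{2}\lambda_3 \wp_{21}+ \lambda_2 \wp_{31} +\frac{3}{2}\lambda_1 \wp_{41} -\frac{1}{2}\lambda_1 \wp_{32}+\lambda_0 \wp_{42}-2\lambda_0 \wp_{33} -\frac{1}{2} \lambda_0 \lambda_6 \\ (34)\quad & \wp_{2111}-6\wp_{21}\wp_{11} =\lambda_2 \wp_{21}+\frac{3}{2}\lambda_1 \wp_{31}-\frac{1}{2}\lambda_1 \wp_{22} +3\lambda_0 \wp_{41}-2\lambda_0 \wp_{32} -\frac{1}{4} \lambda_0 \lambda_5 \\ (35)\quad & \wp_{1111}-6\wp_{11}^2 =\lambda_2 \wp_{11}+\lambda_1 \wp_{21}+4\lambda_0 \wp_{31} -3\lambda_0 \wp_{22} -\frac{1}{2} \lambda_0 \lambda_4+\frac{1}{8} \lambda_1 \lambda_3 \end{aligned}$$ Moreover, if $\Omega\subseteq\mathbb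 C^4$ is open and connected, $U\cap\Omega\ne\emptyset$, and the functions $\wp_{jk}$ on $U\cap\Omega$ are restrictions of holomorphic functions $\wp_{jk}$ ($1\le j,k\le 4$) on $\Omega$, then these continued functions satisfy $\wp_{jk}=\wp_{kj}$ and the same 35 equations on all of $\Omega$. -/

import Mathlib

namespace GenusFour

/-- The right-hand side of the curve `y² = ∑_{k=0}^{9} λ_k x^k`. -/
noncomputable def curveRhs (l : Fin 10 → ℂ) (t : ℂ) : ℂ := ∑ k : Fin 10, l k * t ^ (k : ℕ)

/-- `λ_k` for an arbitrary natural number `k`, with `λ_k = 0` for `k ≥ 10`. -/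
noncomputable def coeffExt (l : Fin 10 → ℂ) (k : ℕ) : ℂ := if h : k < 10 then l ⟨k, h⟩ else 0

/-- The unit vector of `ℂ⁴` in the direction `u_k`; the coordinates are numbered `u₁, …, u₄`
(the coordinate `u_k` of `u` is `u i` with `i + 1 = k`). -/
noncomputable def unitVec (k : ℕ) : Fin 4 → ℂ := fun i => if (i : ℕ) + 1 = k then 1 else 0

/-- The partial derivative `∂φ/∂u_k`, `1 ≤ k ≤ 4`. -/
noncomputable def pderiv (k : ℕ) (φ : (Fin 4 → ℂ) → ℂ) (u : Fin 4 → ℂ) : ℂ :=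
  fderiv ℂ φ u (unitVec k)

/-- A (local, holomorphic, generic) solution of Jacobi's inversion problem
`du_k = ∑_{i=1}^{4} x_i^{k-1} dx_i / y_i`, `1 ≤ k ≤ 4`, on an open set `U` of `ℂ⁴`:
four points `(x_i(u), y_i(u))` of the curve, with distinct `x_i` and nonzero `y_i`. -/
structure JacobiInversion (l : Fin 10 → ℂ) (U : Set (Fin 4 → ℂ))
    (x y : Fin 4 → (Fin 4 → ℂ) → ℂ) : Prop where
  isOpen : IsOpen U
  analytic_x : ∀ i, AnalyticOnNhd ℂ (x i) U
  analytic_y : ∀ i, AnalyticOnNhd ℂ (y i) U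
  on_curve : ∀ u ∈ U, ∀ i, y i u ^ 2 = curveRhs l (x i u)
  x_distinct : ∀ u ∈ U, Function.Injective fun i => x i u
  y_ne_zero : ∀ u ∈ U, ∀ i, y i u ≠ 0
  differentials : ∀ u ∈ U, ∀ v : Fin 4 → ℂ, ∀ k : Fin 4,
    v k = ∑ i : Fin 4, x i u ^ (k : ℕ) / y i u * fderiv ℂ (x i) u v

/-- `χ_{3-j}(x_i; x_m (m ≠ i)) = ∑_a (-1)^a h_a x_i^{3-j-a}` with `h_a` the elementary symmetric
functions of the three `x_m`, `m ≠ i`; it is `0` for `j = 4`. -/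
noncomputable def chiOmit (j : ℕ) (X : Fin 4 → ℂ) (i : Fin 4) : ℂ :=
  ∑ a ∈ Finset.range (4 - j),
    (-1) ^ a * (((Finset.univ.erase i).val.map X).esymm a) * X i ^ (3 - j - a)

/-- `∑_i y_i χ_{3-j}(x_i; x_m (m ≠ i)) / F'(x_i)`, where `F(t) = ∏_m (t - x_m)`, as a function
of `u`. -/
noncomputable def zetaAlgPart (x y : Fin 4 → (Fin 4 → ℂ) → ℂ) (j : ℕ) (u : Fin 4 → ℂ) : ℂ :=
  ∑ i : Fin 4, y i u * chiOmit j (fun m => x m u) i /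
    ∏ m ∈ Finset.univ.erase i, (x i u - x m u)

/-- The differential `d(-ζ_j)` at `u`, evaluated on the tangent vector `v`:
`(1/4) ∑_i (dx_i / y_i) ∑_{k=j}^{9-j} (k+1-j) λ_{k+1+j} x_i^k
  - (1/2) d(∑_i y_i χ_{3-j}(x_i; x_m (m ≠ i)) / F'(x_i))`. -/
noncomputable def negZetaDiff (l : Fin 10 → ℂ) (x y : Fin 4 → (Fin 4 → ℂ) → ℂ) (j : ℕ)
    (u v : Fin 4 → ℂ) : ℂ :=
  1 / 4 * ∑ i : Fin 4, fderiv ℂ (x i) u v / y i u *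
      ∑ k ∈ Finset.Icc j (9 - j), ((k : ℂ) + 1 - (j : ℂ)) * coeffExt l (k + 1 + j) * x i u ^ k
    - 1 / 2 * fderiv ℂ (zetaAlgPart x y j) u v

/-- `℘_{jk} = ∂(-ζ_j)/∂u_k`, `1 ≤ j, k ≤ 4`. -/
noncomputable def wp (l : Fin 10 → ℂ) (x y : Fin 4 → (Fin 4 → ℂ) → ℂ) (j k : ℕ)
    (u : Fin 4 → ℂ) : ℂ :=
  negZetaDiff l x y j u (unitVec k)

/-- `P_{ijkm} = ∂²P_{ij}/∂u_k∂u_m`. -/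
noncomputable def fourIndex (P : ℕ → ℕ → (Fin 4 → ℂ) → ℂ) (i j k m : ℕ) (u : Fin 4 → ℂ) : ℂ :=
  pderiv m (pderiv k (P i j)) u

def Delta2 (p : ℕ → ℕ → ℂ) : ℂ :=
  (-(p 4 4 * p 2 2) + p 4 2 ^ 2) + (p 4 4 * p 3 1 - p 4 3 * p 4 1)
    + (p 4 3 * p 3 2 - p 4 2 * p 3 3)

def Delta3 (p : ℕ → ℕ → ℂ) : ℂ :=
  (p 4 4 * p 2 1 - p 4 2 * p 4 1) + (-(p 4 3 * p 3 1) + p 4 1 * p 3 3)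

def Delta4 (p : ℕ → ℕ → ℂ) : ℂ :=
  (p 4 4 * p 1 1 - p 4 1 ^ 2) + (-(p 4 2 * p 3 1) + p 4 1 * p 3 2)

def Delta5 (p : ℕ → ℕ → ℂ) : ℂ :=
  (p 4 3 * p 1 1 - p 4 1 * p 3 1) + (-(p 4 2 * p 2 1) + p 4 1 * p 2 2)

def Delta7 (p : ℕ → ℕ → ℂ) : ℂ :=
  (-(p 3 3 * p 1 1) + p 3 1 ^ 2) + (p 4 2 * p 1 1 - p 4 1 * p 2 1)
    + (p 3 2 * p 2 1 - p 3 1 * p 2 2)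

/-- The 35 equations, as relations between the values `p j k` of `℘_{jk}` and `q i j k m` of
`℘_{ijkm}` at one point. -/
structure Equations (l : Fin 10 → ℂ) (p : ℕ → ℕ → ℂ) (q : ℕ → ℕ → ℕ → ℕ → ℂ) : Prop where
  eq1 : q 4 4 4 4 - 6 * p 4 4 ^ 2 =
    l 9 * p 4 3 + l 8 * p 4 4 + (1 / 8) * l 7 * l 9
  eq2 : q 4 4 4 3 - 6 * p 4 4 * p 4 3 =
    (3 / 2) * l 9 * p 4 2 - (1 / 2) * l 9 * p 3 3 + l 8 * p 4 3
  eq3 : q 4 4 4 2 - 6 * p 4 4 * p 4 2 =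
    (3 / 2) * l 9 * p 4 1 - (1 / 2) * l 9 * p 3 2 + l 8 * p 4 2
  eq4 : q 4 4 4 1 - 6 * p 4 4 * p 4 1 =
    -(1 / 2) * l 9 * p 3 1 + l 8 * p 4 1
  eq5 : q 4 4 3 3 - 4 * p 4 3 ^ 2 - 2 * p 4 4 * p 3 3 =
    (3 / 2) * l 9 * p 4 1 - (1 / 2) * l 9 * p 3 2 + l 8 * p 4 2 + (1 / 2) * l 7 * p 4 3
  eq6 : q 4 4 3 2 - 4 * p 4 3 * p 4 2 - 2 * p 4 4 * p 3 2 =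
    -(1 / 2) * l 9 * p 3 1 + l 8 * p 4 1 + (1 / 2) * l 7 * p 4 2
  eq7 : q 4 4 3 1 - 4 * p 4 3 * p 4 1 - 2 * p 4 4 * p 3 1 =
    (1 / 2) * l 7 * p 4 1
  eq8 : q 4 4 2 2 - 4 * p 4 2 ^ 2 - 2 * p 4 4 * p 2 2 =
    2 * Delta2 p + (1 / 2) * l 7 * p 4 1
  eq9 : q 4 4 2 1 - 4 * p 4 2 * p 4 1 - 2 * p 4 4 * p 2 1 =
    -2 * Delta3 p
  eq10 : q 4 4 1 1 - 4 * p 4 1 ^ 2 - 2 * p 4 4 * p 1 1 =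
    -2 * Delta4 p
  eq11 : q 4 3 3 3 - 6 * p 4 3 * p 3 3 =
    (3 / 2) * l 9 * p 3 1 - (3 / 2) * l 9 * p 2 2 + l 8 * p 4 1 + l 7 * p 4 2 + l 6 * p 4 3 -
      (1 / 2) * l 5 * p 4 4 - (1 / 4) * l 4 * l 9
  eq12 : q 4 3 3 2 - 4 * p 4 3 * p 3 2 - 2 * p 4 2 * p 3 3 =
    -2 * Delta2 p - l 9 * p 2 1 + l 7 * p 4 1 + l 6 * p 4 2 - (1 / 8) * l 3 * l 9
  eq13 : q 4 3 3 1 - 4 * p 4 3 * p 3 1 - 2 * p 4 1 * p 3 3 =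
    2 * Delta3 p + (1 / 2) * l 9 * p 1 1 + l 6 * p 4 1
  eq14 : q 4 3 2 2 - 4 * p 4 2 * p 3 2 - 2 * p 4 3 * p 2 2 =
    2 * Delta3 p - l 9 * p 1 1 + l 6 * p 4 1 + (1 / 2) * l 5 * p 4 2 - (1 / 4) * l 2 * l 9
  eq15 : q 4 3 2 1 - 2 * p 4 3 * p 2 1 - 2 * p 4 2 * p 3 1 - 2 * p 4 1 * p 3 2 =
    (1 / 2) * l 5 * p 4 1 - (1 / 8) * l 1 * l 9
  eq16 : q 4 3 1 1 - 4 * p 4 1 * p 3 1 - 2 * p 4 3 * p 1 1 =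
    -2 * Delta5 p - (1 / 4) * l 0 * l 9
  eq17 : q 4 2 2 2 - 6 * p 4 2 * p 2 2 =
    6 * Delta4 p + l 5 * p 4 1 + l 4 * p 4 2 - (1 / 2) * l 3 * p 4 3 + l 2 * p 4 4 -
      (1 / 4) * l 1 * l 9
  eq18 : q 4 2 2 1 - 4 * p 4 2 * p 2 1 - 2 * p 4 1 * p 2 2 =
    2 * Delta5 p + l 4 * p 4 1 + (1 / 2) * l 1 * p 4 4 - (1 / 4) * l 0 * l 9
  eq19 : q 4 2 1 1 - 4 * p 4 1 * p 2 1 - 2 * p 4 2 * p 1 1 =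
    (1 / 2) * l 3 * p 4 1 + l 0 * p 4 4
  eq20 : q 4 1 1 1 - 6 * p 4 1 * p 1 1 =
    l 2 * p 4 1 - (1 / 2) * l 1 * p 4 2 + l 0 * p 4 3
  eq21 : q 3 3 3 3 - 6 * p 3 3 ^ 2 =
    12 * Delta2 p - 3 * l 9 * p 2 1 + 4 * l 8 * p 3 1 - 3 * l 8 * p 2 2 + l 7 * p 3 2 +
      l 6 * p 3 3 + l 5 * p 4 3 - 3 * l 4 * p 4 4 + (1 / 8) * l 5 * l 7 - (1 / 2) * l 4 * l 8 -
      (3 / 8) * l 3 * l 9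
  eq22 : q 3 3 3 2 - 6 * p 3 3 * p 3 2 =
    -6 * Delta3 p - (3 / 2) * l 9 * p 1 1 - 2 * l 8 * p 2 1 + (3 / 2) * l 7 * p 3 1 -
      (1 / 2) * l 7 * p 2 2 + l 6 * p 3 2 + l 5 * p 4 2 - (3 / 2) * l 3 * p 4 4 -
      (1 / 2) * l 2 * l 9 - (1 / 4) * l 3 * l 8
  eq23 : q 3 3 3 1 - 6 * p 3 3 * p 3 1 =
    6 * Delta4 p + l 8 * p 1 1 - (1 / 2) * l 7 * p 2 1 + l 6 * p 3 1 + l 5 * p 4 1 -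
      (1 / 4) * l 1 * l 9
  eq24 : q 3 3 2 2 - 4 * p 3 2 ^ 2 - 2 * p 3 3 * p 2 2 =
    -6 * Delta4 p - 2 * l 8 * p 1 1 - (1 / 2) * l 7 * p 2 1 + l 6 * p 3 1 +
      (1 / 2) * l 5 * p 4 1 + (1 / 2) * l 5 * p 3 2 + l 4 * p 4 2 - (1 / 2) * l 3 * p 4 3 -
      2 * l 2 * p 4 4 - (1 / 2) * l 1 * l 9 - (1 / 2) * l 2 * l 8
  eq25 : q 3 3 2 1 - 4 * p 3 2 * p 3 1 - 2 * p 3 3 * p 2 1 =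
    2 * Delta5 p + (1 / 2) * l 5 * p 3 1 + l 4 * p 4 1 - l 1 * p 4 4 - (1 / 4) * l 1 * l 8 -
      (1 / 2) * l 0 * l 9
  eq26 : q 3 3 1 1 - 4 * p 3 1 ^ 2 - 2 * p 3 3 * p 1 1 =
    2 * Delta7 p + (1 / 2) * l 3 * p 4 1 - 2 * l 0 * p 4 4 - (1 / 2) * l 0 * l 8
  eq27 : q 3 2 2 2 - 6 * p 3 2 * p 2 2 =
    -6 * Delta5 p - (3 / 2) * l 7 * p 1 1 + l 5 * p 3 1 + l 4 * p 3 2 + (3 / 2) * l 3 * p 4 2 -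
      (1 / 2) * l 3 * p 3 3 - 2 * l 2 * p 4 3 - (3 / 2) * l 1 * p 4 4 - (3 / 4) * l 0 * l 9 -
      (1 / 2) * l 1 * l 8 - (1 / 4) * l 2 * l 7
  eq28 : q 3 2 2 1 - 4 * p 3 2 * p 2 1 - 2 * p 3 1 * p 2 2 =
    -2 * Delta7 p + l 4 * p 3 1 + l 3 * p 4 1 - l 1 * p 4 3 - l 0 * p 4 4 -
      (1 / 2) * l 0 * l 8 - (1 / 8) * l 1 * l 7
  eq29 : q 3 2 1 1 - 4 * p 3 1 * p 2 1 - 2 * p 3 2 * p 1 1 =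
    (1 / 2) * l 3 * p 3 1 + l 2 * p 4 1 - (1 / 2) * l 1 * p 4 2 - l 0 * p 4 3 -
      (1 / 4) * l 0 * l 7
  eq30 : q 3 1 1 1 - 6 * p 3 1 * p 1 1 =
    l 2 * p 3 1 + (3 / 2) * l 1 * p 4 1 - (1 / 2) * l 1 * p 3 2 - 3 * l 0 * p 4 2 + l 0 * p 3 3
  eq31 : q 2 2 2 2 - 6 * p 2 2 ^ 2 =
    12 * Delta7 p - 3 * l 6 * p 1 1 + l 5 * p 2 1 + l 4 * p 2 2 + l 3 * p 3 2 +
      4 * l 2 * p 4 2 - 3 * l 2 * p 3 3 - 3 * l 1 * p 4 3 - 3 * l 0 * p 4 4 - l 0 * l 8 -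
      (3 / 8) * l 1 * l 7 - (1 / 2) * l 2 * l 6 + (1 / 8) * l 3 * l 5
  eq32 : q 2 2 2 1 - 6 * p 2 2 * p 2 1 =
    -(1 / 2) * l 5 * p 1 1 + l 4 * p 2 1 + l 3 * p 3 1 + l 2 * p 4 1 + (3 / 2) * l 1 * p 4 2 -
      (3 / 2) * l 1 * p 3 3 - 3 * l 0 * p 4 3 - (1 / 2) * l 0 * l 7 - (1 / 4) * l 1 * l 6
  eq33 : q 2 2 1 1 - 4 * p 2 1 ^ 2 - 2 * p 2 2 * p 1 1 =
    (1 / 2) * l 3 * p 2 1 + l 2 * p 3 1 + (3 / 2) * l 1 * p 4 1 - (1 / 2) * l 1 * p 3 2 +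
      l 0 * p 4 2 - 2 * l 0 * p 3 3 - (1 / 2) * l 0 * l 6
  eq34 : q 2 1 1 1 - 6 * p 2 1 * p 1 1 =
    l 2 * p 2 1 + (3 / 2) * l 1 * p 3 1 - (1 / 2) * l 1 * p 2 2 + 3 * l 0 * p 4 1 -
      2 * l 0 * p 3 2 - (1 / 4) * l 0 * l 5
  eq35 : q 1 1 1 1 - 6 * p 1 1 ^ 2 =
    l 2 * p 1 1 + l 1 * p 2 1 + 4 * l 0 * p 3 1 - 3 * l 0 * p 2 2 - (1 / 2) * l 0 * l 4 +
      (1 / 8) * l 1 * l 3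

end GenusFour

namespace GenusFour

open MvPolynomial

/-! The divisor `∑ (x_i, y_i)` is encoded by its Mumford representation: F is monic with roots x_i,
V interpolates V(x_i) = y_i, and f = V² + F W. In these coordinates the whole problem is polynomial,
with no denominators and no branch of y.

Jacobi's differentials are inverted by pairing them with F(z)/(z - x_i), which vanishes at the other
three nodes (`nodeDeriv_mul_pderiv`). Differentiating F(x_i) = 0, V(x_i) = y_i and y_i² = f(x_i)
then gives the vector fields of `flow` (`hasPderiv_state`). With D = ∑_b z^b ∂_{b+1} acting on
polynomials in x they read D F = (V(x)F(z) - F(x)V(z))/(x - z), 2 D V = (F(x)W(z) - W(x)F(z))/(x -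
z) + W_5 F(x)F(z), D W = (W(x)V(z) - V(x)W(z))/(x - z) - W_5 V(x)F(z). The W_5 terms repair the
degrees, since deg W may reach 5. They cancel in 2V·DV + W·DF + F·DW, which is zero, so f is
preserved.

The ℘_{jk} are quadratic in the coefficients (`wp_eq`): ∑ ℘_{jk} x^{j-1} z^{k-1} is the quotient of
g(x,z) - 2V(x)V(z) - F(x)W(z) - F(z)W(x) by 4(x - z)², where g(x,z) = ∑ x^k z^k (2λ_{2k} +
λ_{2k+1}(x + z)). This form is visibly symmetric in j and k.

Fourth-index functions are therefore two applications of polynomial derivations. Once each λ_n is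
replaced by the n-th coefficient of V² + F W, every one of the 35 equations is an identity in the
free variables F_0..F_3, V_0..V_3, W_0..W_5 (`equations_of_isMumford`). The extension to Ω is the
identity theorem for analytic functions. -/

/-- `φ` is differentiable at `u` with partial derivative `∂φ/∂u_k = d`. -/
def HasPderiv (k : ℕ) (φ : (Fin 4 → ℂ) → ℂ) (d : ℂ) (u : Fin 4 → ℂ) : Prop :=
  DifferentiableAt ℂ φ u ∧ pderiv k φ u = d

/-! ### Calculus of partial derivatives -/

namespace HasPderiv

variable {k : ℕ} {φ ψ : (Fin 4 → ℂ) → ℂ} {d e : ℂ} {u : Fin 4 → ℂ}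

theorem const (k : ℕ) (c : ℂ) (u : Fin 4 → ℂ) : HasPderiv k (fun _ => c) 0 u :=
  ⟨differentiableAt_const c, by simp [pderiv]⟩

theorem add (hφ : HasPderiv k φ d u) (hψ : HasPderiv k ψ e u) :
    HasPderiv k (fun z => φ z + ψ z) (d + e) u :=
  ⟨hφ.1.fun_add hψ.1, by
    rw [← hφ.2, ← hψ.2]; simp [pderiv, fderiv_fun_add hφ.1 hψ.1]⟩

theorem sub (hφ : HasPderiv k φ d u) (hψ : HasPderiv k ψ e u) :
    HasPderiv k (fun z => φ z - ψ z) (d - e) u :=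
  ⟨hφ.1.fun_sub hψ.1, by
    rw [← hφ.2, ← hψ.2]; simp [pderiv, fderiv_fun_sub hφ.1 hψ.1]⟩

theorem mul (hφ : HasPderiv k φ d u) (hψ : HasPderiv k ψ e u) :
    HasPderiv k (fun z => φ z * ψ z) (φ u * e + d * ψ u) u :=
  ⟨hφ.1.fun_mul hψ.1, by
    rw [← hφ.2, ← hψ.2]; simp [pderiv, fderiv_fun_mul hφ.1 hψ.1]; ring⟩

theorem const_mul (c : ℂ) (hφ : HasPderiv k φ d u) :
    HasPderiv k (fun z => c * φ z) (c * d) u := by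
  simpa using (const k c u).mul hφ

theorem pow (hφ : HasPderiv k φ d u) (n : ℕ) :
    HasPderiv k (fun z => φ z ^ n) (n * φ u ^ (n - 1) * d) u :=
  ⟨hφ.1.fun_pow n, by
    rw [← hφ.2]; simp [pderiv, fderiv_fun_pow n hφ.1]⟩

theorem sum {ι : Type*} {s : Finset ι} {Φ : ι → (Fin 4 → ℂ) → ℂ} {D : ι → ℂ}
    (h : ∀ i ∈ s, HasPderiv k (Φ i) (D i) u) :
    HasPderiv k (fun z => ∑ i ∈ s, Φ i z) (∑ i ∈ s, D i) u :=
  ⟨DifferentiableAt.fun_sum fun i hi => (h i hi).1, by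
    simp only [pderiv]
    rw [fderiv_fun_sum fun i hi => (h i hi).1, _root_.sum_apply]
    exact Finset.sum_congr rfl fun i hi => (h i hi).2⟩

theorem congr_deriv (hφ : HasPderiv k φ d u) (h : d = e) : HasPderiv k φ e u := h ▸ hφ

theorem congr_of_eqOn {U : Set (Fin 4 → ℂ)} (hφ : HasPderiv k φ d u) (hU : IsOpen U)
    (hu : u ∈ U) (h : ∀ z ∈ U, ψ z = φ z) : HasPderiv k ψ d u := by
  have he : ψ =ᶠ[nhds u] φ := Filter.eventuallyEq_of_mem (hU.mem_nhds hu) h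
  refine ⟨hφ.1.congr_of_eventuallyEq he, ?_⟩
  rw [← hφ.2, pderiv, pderiv, he.fderiv_eq]

theorem unique (hφ : HasPderiv k φ d u) (hφ' : HasPderiv k φ e u) : d = e :=
  hφ.2.symm.trans hφ'.2

/-- Partial derivatives of a polynomial in functions whose partial derivatives are themselves
polynomials in these functions. -/
theorem eval {σ : Type*} {s : (Fin 4 → ℂ) → σ → ℂ} {δ : σ → MvPolynomial σ ℂ}
    (h : ∀ g, HasPderiv k (fun z => s z g) (MvPolynomial.eval (s u) (δ g)) u)
    (p : MvPolynomial σ ℂ) :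
    HasPderiv k (fun z => MvPolynomial.eval (s z) p)
      (MvPolynomial.eval (s u) (mkDerivation ℂ δ p)) u := by
  induction p using MvPolynomial.induction_on with
  | C a => simpa using const k a u
  | add p q hp hq => simpa using hp.add hq
  | mul_X p g hp =>
    refine (by simpa using hp.mul (h g) : HasPderiv k _ _ u).congr_deriv ?_
    simp [Derivation.leibniz, mul_comm]

end HasPderiv

/-! ### Mumford coordinates, their polynomial flows, and the 35 identities -/

/-- The coefficient of `x^a z^b` in `(A(x) B(z) - B(x) A(z)) / (x - z)`. -/
def bezout {R : Type*} [CommRing R] (A B : ℕ → R) (a b : ℕ) : R :=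
  ∑ m ∈ Finset.range (b + 1), (A (a + (b + 1 - m)) * B m - B (a + (b + 1 - m)) * A m)

/-- Indices for the coefficients of the three polynomials `F`, `V`, `W` of the Mumford
representation `f = V² + F W` of a divisor `∑ (x_i, y_i)`. -/
inductive Gen
  | F (a : ℕ)
  | V (a : ℕ)
  | W (a : ℕ)

/-- The derivative along `u_{b+1}` of the coefficients of `F`, `V`, `W`. -/
noncomputable def flow (b : ℕ) : Gen → MvPolynomial Gen ℂ
  | .F a => bezout (fun n => X (.V n)) (fun n => X (.F n)) a b
  | .V a => C (1 / 2) * (bezout (fun n => X (.F n)) (fun n => X (.W n)) a b +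
      X (.W 5) * X (.F a) * X (.F b))
  | .W a => bezout (fun n => X (.W n)) (fun n => X (.V n)) a b - X (.W 5) * X (.V a) * X (.F b)

/-- The values of coefficients of polynomials `F`, `V`, `W` with `F` monic of degree `4`,
`deg V ≤ 3`, `deg W ≤ 5` and `V² + F W = f`. -/
structure IsMumford (l : Fin 10 → ℂ) (s : Gen → ℂ) : Prop where
  monic : s (.F 4) = 1
  F_zero : ∀ n, 5 ≤ n → s (.F n) = 0
  V_zero : ∀ n, 4 ≤ n → s (.V n) = 0
  W_zero : ∀ n, 6 ≤ n → s (.W n) = 0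
  coeff : ∀ n : Fin 10, l n = ∑ a ∈ Finset.range (n + 1),
    (s (.V a) * s (.V (n - a)) + s (.F a) * s (.W (n - a)))

/-- The functions `℘_{jk}` in terms of the coefficients of `F`, `V`, `W`. -/
noncomputable def wpPoly : ℕ → ℕ → MvPolynomial Gen ℂ
  | 1, 1 => -(C (1 / 4) * (X (.F 0) * X (.W 2))) - C (1 / 4) * (X (.F 2) * X (.W 0))
      - C (1 / 2) * (X (.V 0) * X (.V 2))
  | 2, 1 | 1, 2 => -(C (1 / 4) * (X (.F 0) * X (.W 3))) - C (1 / 4) * (X (.F 3) * X (.W 0))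
      - C (1 / 2) * (X (.V 0) * X (.V 3))
  | 2, 2 => -(C (1 / 2) * (X (.F 0) * X (.W 4))) - C (1 / 4) * (X (.F 1) * X (.W 3))
      - C (1 / 4) * (X (.F 3) * X (.W 1)) - C (1 / 2) * (X (.V 1) * X (.V 3))
      - C (1 / 2) * X (.W 0)
  | 3, 1 | 1, 3 => -(C (1 / 4) * (X (.F 0) * X (.W 4))) - C (1 / 4) * X (.W 0)
  | 3, 2 | 2, 3 => -(C (1 / 2) * (X (.F 0) * X (.W 5))) - C (1 / 4) * (X (.F 1) * X (.W 4))
      - C (1 / 4) * X (.W 1)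
  | 3, 3 => -(C (1 / 2) * (X (.F 1) * X (.W 5))) - C (1 / 4) * (X (.F 2) * X (.W 4))
      - C (1 / 4) * X (.W 2)
  | 4, 1 | 1, 4 => -(C (1 / 4) * (X (.F 0) * X (.W 5)))
  | 4, 2 | 2, 4 => -(C (1 / 4) * (X (.F 1) * X (.W 5)))
  | 4, 3 | 3, 4 => -(C (1 / 4) * (X (.F 2) * X (.W 5)))
  | 4, 4 => -(C (1 / 4) * (X (.F 3) * X (.W 5)))
  | _, _ => 0

theorem wpPoly_comm (j k : ℕ) (hj : j ∈ Finset.Icc 1 4) (hk : k ∈ Finset.Icc 1 4) :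
    wpPoly j k = wpPoly k j := by
  simp only [Finset.mem_Icc] at hj hk
  obtain ⟨_, _⟩ := hj
  obtain ⟨_, _⟩ := hk
  interval_cases j <;> interval_cases k <;> rfl

/-- The second derivative of `℘_{ij}` along `u_k` and `u_m`. -/
noncomputable def wpPoly₄ (i j k m : ℕ) : MvPolynomial Gen ℂ :=
  mkDerivation ℂ (flow (m - 1)) (mkDerivation ℂ (flow (k - 1)) (wpPoly i j))

theorem IsMumford.coeff_eq {l : Fin 10 → ℂ} {s : Gen → ℂ} (h : IsMumford l s) :
    l 0 = s (.V 0) ^ 2 + s (.F 0) * s (.W 0) ∧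
    l 1 = 2 * s (.V 0) * s (.V 1) + s (.F 0) * s (.W 1) + s (.F 1) * s (.W 0) ∧
    l 2 = 2 * s (.V 0) * s (.V 2) + s (.V 1) ^ 2 + s (.F 0) * s (.W 2) + s (.F 1) * s (.W 1) +
      s (.F 2) * s (.W 0) ∧
    l 3 = 2 * s (.V 0) * s (.V 3) + 2 * s (.V 1) * s (.V 2) + s (.F 0) * s (.W 3) +
      s (.F 1) * s (.W 2) + s (.F 2) * s (.W 1) + s (.F 3) * s (.W 0) ∧
    l 4 = 2 * s (.V 1) * s (.V 3) + s (.V 2) ^ 2 + s (.F 0) * s (.W 4) + s (.F 1) * s (.W 3) +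
      s (.F 2) * s (.W 2) + s (.F 3) * s (.W 1) + s (.W 0) ∧
    l 5 = 2 * s (.V 2) * s (.V 3) + s (.F 0) * s (.W 5) + s (.F 1) * s (.W 4) +
      s (.F 2) * s (.W 3) + s (.F 3) * s (.W 2) + s (.W 1) ∧
    l 6 = s (.V 3) ^ 2 + s (.F 1) * s (.W 5) + s (.F 2) * s (.W 4) + s (.F 3) * s (.W 3) +
      s (.W 2) ∧
    l 7 = s (.F 2) * s (.W 5) + s (.F 3) * s (.W 4) + s (.W 3) ∧
    l 8 = s (.F 3) * s (.W 5) + s (.W 4) ∧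
    l 9 = s (.W 5) := by
  refine ⟨?_, ?_, ?_, ?_, ?_, ?_, ?_, ?_, ?_, ?_⟩ <;> rw [h.coeff] <;>
    simp [Finset.sum_range_succ, h.monic, h.F_zero, h.V_zero, h.W_zero] <;> ring

-- No relation among the coefficients remains after the λ_n are eliminated, so each equation is a
-- formal polynomial identity.
set_option linter.unusedSimpArgs false in
set_option maxHeartbeats 4000000 in
theorem equations_of_isMumford {l : Fin 10 → ℂ} {s : Gen → ℂ} (h : IsMumford l s) :
    Equations l (fun j k => eval s (wpPoly j k)) (fun i j k m => eval s (wpPoly₄ i j k m)) := by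
  obtain ⟨h0, h1, h2, h3, h4, h5, h6, h7, h8, h9⟩ := h.coeff_eq
  constructor <;>
    simp only [wpPoly₄, wpPoly, flow, bezout, Finset.sum_range_succ, Finset.sum_range_zero,
      map_add, map_sub, map_neg, Derivation.leibniz, mkDerivation_X, derivation_C, smul_eq_mul,
      smul_zero, zero_add, add_zero, Nat.reduceAdd, Nat.reduceSub, mul_zero, Delta2, Delta3,
      Delta4, Delta5, Delta7, h0, h1, h2, h3, h4, h5, h6, h7, h8, h9] <;>
    -- Evaluation comes only after both derivations. `Gen` has generators of every degree, and
    -- `flow` produces out-of-range ones that become 0 (or 1, for F_4) only at `s`.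
    simp only [map_add, map_sub, map_neg, map_mul, map_zero, eval_X, eval_C, h.monic, h.F_zero,
      h.V_zero, h.W_zero, le_refl, Nat.reduceLeDiff, mul_zero, zero_mul, add_zero, zero_add,
      sub_zero, zero_sub] <;>
    ring

/-! ### Constructing F, V, W from four points -/

/-- The coefficients of `F(t) = ∏_i (t - X_i)`. -/
def elemCoeff (X : Fin 4 → ℂ) : ℕ → ℂ
  | 0 => X 0 * X 1 * X 2 * X 3
  | 1 => -(X 0 * X 1 * X 2 + X 0 * X 1 * X 3 + X 0 * X 2 * X 3 + X 1 * X 2 * X 3)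
  | 2 => X 0 * X 1 + X 0 * X 2 + X 0 * X 3 + X 1 * X 2 + X 1 * X 3 + X 2 * X 3
  | 3 => -(X 0 + X 1 + X 2 + X 3)
  | 4 => 1
  | _ => 0

/-- `∑_{m ≥ k} F_m t^{m-k}`; for a root `t` of `F` these are, for `1 ≤ k ≤ 4`, the coefficients of
`F(z) / (z - t)`. -/
def tail (F : ℕ → ℂ) (k : ℕ) (t : ℂ) : ℂ := ∑ m ∈ Finset.range (5 - k), F (k + m) * t ^ m

/-- `F'(X_i)` for `F(t) = ∏_i (t - X_i)`. -/
def nodeDeriv (X : Fin 4 → ℂ) (i : Fin 4) : ℂ := ∏ m ∈ Finset.univ.erase i, (X i - X m)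

/-- The coefficients of the interpolation polynomial with `V(X_i) = Y_i`. -/
noncomputable def interpCoeff (X Y : Fin 4 → ℂ) (a : ℕ) : ℂ :=
  ∑ i, Y i * tail (elemCoeff X) (a + 1) (X i) / nodeDeriv X i

/-- The coefficients of the quotient `W` of `f - V²` by the monic polynomial `F`. -/
def quotCoeff (l : Fin 10 → ℂ) (F V : ℕ → ℂ) : ℕ → ℂ :=
  let w₄ := l 8 - F 3 * l 9
  let w₃ := l 7 - F 3 * w₄ - F 2 * l 9
  let w₂ := l 6 - V 3 * V 3 - F 3 * w₃ - F 2 * w₄ - F 1 * l 9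
  let w₁ := l 5 - 2 * (V 2 * V 3) - F 3 * w₂ - F 2 * w₃ - F 1 * w₄ - F 0 * l 9
  let w₀ := l 4 - 2 * (V 1 * V 3) - V 2 * V 2 - F 3 * w₁ - F 2 * w₂ - F 1 * w₃ - F 0 * w₄
  fun
  | 0 => w₀
  | 1 => w₁
  | 2 => w₂
  | 3 => w₃
  | 4 => w₄
  | 5 => l 9
  | _ => 0

/-- The Mumford representation of the divisor `∑_i (X_i, Y_i)`. -/
noncomputable def mumford (l : Fin 10 → ℂ) (X Y : Fin 4 → ℂ) : Gen → ℂ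
  | .F a => elemCoeff X a
  | .V a => interpCoeff X Y a
  | .W a => quotCoeff l (elemCoeff X) (interpCoeff X Y) a

theorem prod_univ_erase (g : Fin 4 → ℂ) (i : Fin 4) :
    ∏ m ∈ Finset.univ.erase i, g m =
      ![g 1 * g 2 * g 3, g 0 * g 2 * g 3, g 0 * g 1 * g 3, g 0 * g 1 * g 2] i := by
  fin_cases i
  · rw [show Finset.univ.erase (⟨0, by decide⟩ : Fin 4) = {1, 2, 3} by decide]
    simp; ring
  · rw [show Finset.univ.erase (⟨1, by decide⟩ : Fin 4) = {0, 2, 3} by decide]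
    simp; ring
  · rw [show Finset.univ.erase (⟨2, by decide⟩ : Fin 4) = {0, 1, 3} by decide]
    simp; ring
  · rw [show Finset.univ.erase (⟨3, by decide⟩ : Fin 4) = {0, 1, 2} by decide]
    simp; ring

theorem nodeDeriv_ne_zero {X : Fin 4 → ℂ} (hX : Function.Injective X) (i : Fin 4) :
    nodeDeriv X i ≠ 0 :=
  Finset.prod_ne_zero_iff.2 fun _ hm =>
    sub_ne_zero.2 fun h => (Finset.ne_of_mem_erase hm) (hX h).symm

theorem tail_of_five_le (F : ℕ → ℂ) {k : ℕ} (hk : 5 ≤ k) (t : ℂ) : tail F k t = 0 := by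
  simp [tail, Nat.sub_eq_zero_of_le hk]

theorem sum_elemCoeff_mul_pow (X : Fin 4 → ℂ) (i : Fin 4) :
    ∑ a ∈ Finset.range 5, elemCoeff X a * X i ^ a = 0 := by
  fin_cases i <;> simp [Finset.sum_range_succ, elemCoeff] <;> ring

theorem nodeDeriv_eq (X : Fin 4 → ℂ) (i : Fin 4) :
    nodeDeriv X i = elemCoeff X 1 + 2 * elemCoeff X 2 * X i + 3 * elemCoeff X 3 * X i ^ 2 +
      4 * X i ^ 3 := by
  rw [nodeDeriv, prod_univ_erase]
  fin_cases i <;> simp [elemCoeff] <;> ring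

theorem sum_tail_mul_pow (X : Fin 4 → ℂ) (i : Fin 4) (t : ℂ) :
    ∑ a ∈ Finset.range 4, tail (elemCoeff X) (a + 1) (X i) * t ^ a =
      ∏ m ∈ Finset.univ.erase i, (t - X m) := by
  rw [prod_univ_erase]
  fin_cases i <;> simp [tail, Finset.sum_range_succ, elemCoeff] <;> ring

/-- Lagrange interpolation: F(z)/((z - X_j) F'(X_j)) is 1 at X_j and 0 at the other nodes. -/
theorem sum_interpCoeff_mul_pow {X : Fin 4 → ℂ} (hX : Function.Injective X) (Y : Fin 4 → ℂ)
    (i : Fin 4) : ∑ a ∈ Finset.range 4, interpCoeff X Y a * X i ^ a = Y i := by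
  have h : ∀ j, ∑ a ∈ Finset.range 4,
      Y j * tail (elemCoeff X) (a + 1) (X j) / nodeDeriv X j * X i ^ a =
        Y j / nodeDeriv X j * ∏ m ∈ Finset.univ.erase j, (X i - X m) := fun j => by
    rw [← sum_tail_mul_pow, Finset.mul_sum]
    exact Finset.sum_congr rfl fun a _ => by ring
  simp only [interpCoeff, Finset.sum_mul]
  rw [Finset.sum_comm, Finset.sum_congr rfl fun j _ => h j, Finset.sum_eq_single i]
  · exact div_mul_cancel₀ _ (nodeDeriv_ne_zero hX i)
  · intro j _ hj
    rw [Finset.prod_eq_zero (Finset.mem_erase.2 ⟨hj.symm, Finset.mem_univ i⟩) (sub_self _),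
      mul_zero]
  · simp

/-- A polynomial of degree at most three with four distinct roots vanishes. -/
theorem eq_zero_of_sum_mul_pow {X : Fin 4 → ℂ} (hX : Function.Injective X) {c : ℕ → ℂ}
    (h : ∀ i, ∑ a ∈ Finset.range 4, c a * X i ^ a = 0) {a : ℕ} (ha : a < 4) : c a = 0 := by
  have := Matrix.eq_zero_of_forall_index_sum_mul_pow_eq_zero (v := fun a : Fin 4 => c a) hX
    fun i => by simpa [Fin.sum_univ_eq_sum_range (fun a => c a * X i ^ a)] using h i
  exact congrFun this ⟨a, ha⟩

/-- Since V(X_i)² = Y_i² = f(X_i), the remainder of f - V² on division by F has degree at most three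
and vanishes at four distinct nodes, hence is zero. -/
theorem isMumford_mumford {l : Fin 10 → ℂ} {X Y : Fin 4 → ℂ} (hX : Function.Injective X)
    (hY : ∀ i, Y i ^ 2 = curveRhs l (X i)) : IsMumford l (mumford l X Y) := by
  have hF : ∀ n, 5 ≤ n → elemCoeff X n = 0 := fun n hn => by
    obtain ⟨m, rfl⟩ := Nat.exists_eq_add_of_le' hn
    rfl
  have hV : ∀ n, 4 ≤ n → interpCoeff X Y n = 0 := fun n hn => by
    simp [interpCoeff, tail_of_five_le _ (Nat.succ_le_succ hn)]
  have hW : ∀ n, 6 ≤ n → quotCoeff l (elemCoeff X) (interpCoeff X Y) n = 0 := fun n hn => by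
    obtain ⟨m, rfl⟩ := Nat.exists_eq_add_of_le' hn
    rfl
  have hF4 : elemCoeff X 4 = 1 := rfl
  set F := elemCoeff X with hFdef
  set V := interpCoeff X Y with hVdef
  set W := quotCoeff l F V with hWdef
  have hW5 : W 5 = l 9 := rfl
  have hW4 : W 4 = l 8 - F 3 * W 5 := rfl
  have hW3 : W 3 = l 7 - F 3 * W 4 - F 2 * W 5 := rfl
  have hW2 : W 2 = l 6 - V 3 * V 3 - F 3 * W 3 - F 2 * W 4 - F 1 * W 5 := rfl
  have hW1 : W 1 = l 5 - 2 * (V 2 * V 3) - F 3 * W 2 - F 2 * W 3 - F 1 * W 4 - F 0 * W 5 := rfl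
  have hW0 : W 0 = l 4 - 2 * (V 1 * V 3) - V 2 * V 2 - F 3 * W 1 - F 2 * W 2 - F 1 * W 3 -
    F 0 * W 4 := rfl
  -- The coefficients of V² + F W - f. Those of degree 4 to 9 vanish by the choice of W_0..W_5;
  -- those below 4 form the remainder, up to sign.
  let c : ℕ → ℂ := fun n => (∑ a ∈ Finset.range (n + 1), (V a * V (n - a) + F a * W (n - a))) -
    coeffExt l n
  have hc : ∀ n < 4, c n = 0 := by
    refine fun n hn => eq_zero_of_sum_mul_pow hX (fun i => ?_) hn
    have h1 := sum_elemCoeff_mul_pow X i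
    have h2 := sum_interpCoeff_mul_pow hX Y i
    have h3 := hY i
    rw [curveRhs] at h3
    simp only [← hFdef, ← hVdef, Fin.sum_univ_succ, Finset.sum_range_succ] at h1 h2 h3
    simp [hF4] at h1 h2 h3
    simp [c, Finset.sum_range_succ, coeffExt]
    -- The factors are W(X_i) for F(X_i) = 0 and V(X_i) + Y_i for V(X_i) = Y_i. The defining
    -- equations of W, weighted by X_i^4, …, X_i^9, remove the upper part of V² + F W - f.
    linear_combination
      (W 0 + W 1 * X i + W 2 * X i ^ 2 + W 3 * X i ^ 3 + W 4 * X i ^ 4 + W 5 * X i ^ 5) * h1 +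
      (V 0 + V 1 * X i + V 2 * X i ^ 2 + V 3 * X i ^ 3 + Y i) * h2 + h3 - X i ^ 9 * hW5 -
      X i ^ 8 * hW4 - X i ^ 7 * hW3 - X i ^ 6 * hW2 - X i ^ 5 * hW1 - X i ^ 4 * hW0
  refine ⟨hF4, hF, hV, hW, fun n => ?_⟩
  have hc' : ∀ n : Fin 10, (n : ℕ) < 4 →
      ∑ a ∈ Finset.range (n + 1), (V a * V (n - a) + F a * W (n - a)) = l n := fun n hn => by
    simpa [c, coeffExt, sub_eq_zero] using hc n hn
  simp only [mumford, ← hFdef, ← hVdef, ← hWdef]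
  fin_cases n
  · exact (hc' 0 (by decide)).symm
  · exact (hc' 1 (by decide)).symm
  · exact (hc' 2 (by decide)).symm
  · exact (hc' 3 (by decide)).symm
  · simp [Finset.sum_range_succ, hF4, hV]; linear_combination -hW0
  · simp [Finset.sum_range_succ, hF4, hF, hV]; linear_combination -hW1
  · simp [Finset.sum_range_succ, hF4, hF, hV, hW]; linear_combination -hW2
  · simp [Finset.sum_range_succ, hF4, hF, hV, hW]; linear_combination -hW3
  · simp [Finset.sum_range_succ, hF4, hF, hV, hW]; linear_combination -hW4
  · simp [Finset.sum_range_succ, hF4, hF, hV, hW]; linear_combination -hW5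

/-! ### The symmetric functions in the algebraic part of ζ_j -/

theorem esymm_triple (a b c : ℂ) :
    ({a, b, c} : Multiset ℂ).esymm 0 = 1 ∧ ({a, b, c} : Multiset ℂ).esymm 1 = a + b + c ∧
    ({a, b, c} : Multiset ℂ).esymm 2 = a * b + a * c + b * c := by
  refine ⟨?_, ?_, ?_⟩
  · simp [Multiset.esymm]
  · simp [Multiset.esymm, Multiset.powersetCard_one]; ring
  · simp [Multiset.esymm, Multiset.powersetCard_cons, Multiset.powersetCard_one,
      Multiset.insert_eq_cons]
    ring

/-- The tails are (up to sign) the elementary symmetric functions of the other three nodes.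
Rewriting the powers of X_i with the full power sums p_1 = -F_3 and p_2 = F_3² - 2F_2 makes all
multipliers independent of i, so that summing over i yields combinations of the V_a. -/
theorem chiOmit_eq (X : Fin 4 → ℂ) (i : Fin 4) :
    chiOmit 4 X i = 0 ∧ chiOmit 3 X i = tail (elemCoeff X) 4 (X i) ∧
    chiOmit 2 X i = 2 * tail (elemCoeff X) 3 (X i) - elemCoeff X 3 * tail (elemCoeff X) 4 (X i) ∧
    chiOmit 1 X i = 3 * tail (elemCoeff X) 2 (X i) - elemCoeff X 3 * tail (elemCoeff X) 3 (X i) +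
      (elemCoeff X 3 ^ 2 - 2 * elemCoeff X 2) * tail (elemCoeff X) 4 (X i) := by
  have h : ∃ a b c, (Finset.univ.erase i).val.map X = {a, b, c} ∧
      elemCoeff X 3 = -(X i + a + b + c) ∧
      elemCoeff X 2 = X i * (a + b + c) + (a * b + a * c + b * c) := by
    fin_cases i
    · exact ⟨X 1, X 2, X 3, rfl, by simp [elemCoeff], by simp [elemCoeff]; ring⟩
    · exact ⟨X 0, X 2, X 3, rfl, by simp [elemCoeff]; ring, by simp [elemCoeff]; ring⟩
    · exact ⟨X 0, X 1, X 3, rfl, by simp [elemCoeff]; ring, by simp [elemCoeff]; ring⟩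
    · exact ⟨X 0, X 1, X 2, rfl, by simp [elemCoeff]; ring, by simp [elemCoeff]; ring⟩
  obtain ⟨a, b, c, h, h3, h2⟩ := h
  obtain ⟨e0, e1, e2⟩ := esymm_triple a b c
  have h4 : elemCoeff X 4 = 1 := rfl
  simp only [chiOmit, h]
  refine ⟨?_, ?_, ?_, ?_⟩ <;>
    simp [tail, Finset.sum_range_succ, -Multiset.insert_eq_cons, e0, e1, e2, h2, h3, h4] <;> ring

/-! ### The flow of Jacobi inversion in Mumford coordinates -/

namespace JacobiInversion

variable {l : Fin 10 → ℂ} {U : Set (Fin 4 → ℂ)} {x y : Fin 4 → (Fin 4 → ℂ) → ℂ}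

/-- The coefficients of the Mumford representation of the solution, as functions of `u`. -/
noncomputable def state (l : Fin 10 → ℂ) (x y : Fin 4 → (Fin 4 → ℂ) → ℂ) (u : Fin 4 → ℂ) :
    Gen → ℂ := mumford l (fun i => x i u) (fun i => y i u)

theorem isMumford (h : JacobiInversion l U x y) {u : Fin 4 → ℂ} (hu : u ∈ U) :
    IsMumford l (state l x y u) :=
  isMumford_mumford (h.x_distinct u hu) (h.on_curve u hu)

theorem hasPderiv_x (h : JacobiInversion l U x y) {u : Fin 4 → ℂ} (hu : u ∈ U) (k : ℕ)
    (i : Fin 4) : HasPderiv k (x i) (pderiv k (x i) u) u :=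
  ⟨(h.analytic_x i u hu).differentiableAt, rfl⟩

theorem hasPderiv_y (h : JacobiInversion l U x y) {u : Fin 4 → ℂ} (hu : u ∈ U) (k : ℕ)
    (i : Fin 4) : HasPderiv k (y i) (pderiv k (y i) u) u :=
  ⟨(h.analytic_y i u hu).differentiableAt, rfl⟩

/-- The power sums `∑_i x_i^a ∂_{b+1} x_i / y_i`, for `a ≤ 3`. -/
theorem sum_pow_mul (h : JacobiInversion l U x y) {u : Fin 4 → ℂ} (hu : u ∈ U) {a b : ℕ}
    (ha : a < 4) :
    ∑ i, x i u ^ a * (pderiv (b + 1) (x i) u / y i u) = if a = b then 1 else 0 := by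
  have := h.differentials u hu (unitVec (b + 1)) ⟨a, ha⟩
  simp only [unitVec, Nat.add_right_cancel_iff] at this
  rw [this]
  exact Finset.sum_congr rfl fun i _ => by rw [pderiv]; ring

/-- The recursion for the power sums `∑_i x_i^a ∂_k x_i / y_i`. -/
theorem sum_pow_add_four_mul (u : Fin 4 → ℂ) (k n : ℕ) :
    ∑ i, x i u ^ (n + 4) * (pderiv k (x i) u / y i u) =
      -(state l x y u (.F 3) * ∑ i, x i u ^ (n + 3) * (pderiv k (x i) u / y i u) +
        state l x y u (.F 2) * ∑ i, x i u ^ (n + 2) * (pderiv k (x i) u / y i u) +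
        state l x y u (.F 1) * ∑ i, x i u ^ (n + 1) * (pderiv k (x i) u / y i u) +
        state l x y u (.F 0) * ∑ i, x i u ^ n * (pderiv k (x i) u / y i u)) := by
  simp only [Finset.mul_sum, ← Finset.sum_add_distrib, ← Finset.sum_neg_distrib]
  refine Finset.sum_congr rfl fun i _ => ?_
  have hF := sum_elemCoeff_mul_pow (fun i => x i u) i
  have hF4 : elemCoeff (fun i => x i u) 4 = 1 := rfl
  simp only [Finset.sum_range_succ, Finset.sum_range_zero, hF4] at hF
  simp only [state, mumford]
  linear_combination (x i u ^ n * (pderiv k (x i) u / y i u)) * hF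

/-- Weighting the power sums of degree 0 to 3 by the coefficients of F(z)/(z - x_i) kills every
summand except the i-th, which solves the Jacobi system for ∂x_i. -/
theorem nodeDeriv_mul_pderiv (h : JacobiInversion l U x y) {u : Fin 4 → ℂ} (hu : u ∈ U) {b : ℕ}
    (hb : b < 4) (i : Fin 4) :
    nodeDeriv (fun i => x i u) i * pderiv (b + 1) (x i) u =
      y i u * tail (elemCoeff fun i => x i u) (b + 1) (x i u) := by
  set X : Fin 4 → ℂ := fun i => x i u with hX
  have h1 : ∑ j, (∑ a ∈ Finset.range 4, tail (elemCoeff X) (a + 1) (X i) * X j ^ a) *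
      (pderiv (b + 1) (x j) u / y j u) = tail (elemCoeff X) (b + 1) (X i) := by
    simp only [Finset.sum_mul]
    rw [Finset.sum_comm]
    have : ∀ a ∈ Finset.range 4, ∑ j, tail (elemCoeff X) (a + 1) (X i) * X j ^ a *
        (pderiv (b + 1) (x j) u / y j u) =
          tail (elemCoeff X) (a + 1) (X i) * if a = b then 1 else 0 := fun a ha => by
      rw [← h.sum_pow_mul hu (Finset.mem_range.1 ha), Finset.mul_sum]
      exact Finset.sum_congr rfl fun j _ => mul_assoc _ _ _
    rw [Finset.sum_congr rfl this]
    simp [hb]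
  rw [Finset.sum_eq_single i] at h1
  · rw [sum_tail_mul_pow] at h1
    change _ = y i u * tail (elemCoeff X) (b + 1) (X i)
    rw [← h1, nodeDeriv]
    field_simp [h.y_ne_zero u hu i]
  · intro j _ hj
    rw [sum_tail_mul_pow, Finset.prod_eq_zero (Finset.mem_erase.2 ⟨hj, Finset.mem_univ j⟩)
      (sub_self _), zero_mul]
  · simp

theorem differentiableAt_F (h : JacobiInversion l U x y) {u : Fin 4 → ℂ} (hu : u ∈ U) (a : ℕ) :
    DifferentiableAt ℂ (fun z => state l x y z (.F a)) u := by
  have hx : ∀ i, DifferentiableAt ℂ (x i) u := fun i => (h.analytic_x i u hu).differentiableAt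
  match a with
  | 0 | 1 | 2 | 3 | 4 | _ + 5 => simp only [state, mumford, elemCoeff]; fun_prop

theorem differentiableAt_V (h : JacobiInversion l U x y) {u : Fin 4 → ℂ} (hu : u ∈ U) (a : ℕ) :
    DifferentiableAt ℂ (fun z => state l x y z (.V a)) u := by
  have hx : ∀ i, DifferentiableAt ℂ (x i) u := fun i => (h.analytic_x i u hu).differentiableAt
  have hy : ∀ i, DifferentiableAt ℂ (y i) u := fun i => (h.analytic_y i u hu).differentiableAt
  have hF : ∀ a, DifferentiableAt ℂ (fun z => elemCoeff (fun i => x i z) a) u :=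
    h.differentiableAt_F hu
  have hn := nodeDeriv_ne_zero (h.x_distinct u hu)
  simp only [state, mumford, interpCoeff, tail]
  refine DifferentiableAt.fun_sum fun i _ => ?_
  simp only [div_eq_mul_inv]
  refine DifferentiableAt.fun_mul (by fun_prop) (DifferentiableAt.fun_inv ?_ (hn i))
  simp only [nodeDeriv]
  fun_prop

theorem eval_flow_F_eq_zero {s : Gen → ℂ} (h : IsMumford l s) {a : ℕ} (ha : 4 ≤ a) (b : ℕ) :
    eval s (flow b (.F a)) = 0 := by
  simp only [flow, bezout, map_sum, map_sub, map_mul, eval_X]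
  refine Finset.sum_eq_zero fun m hm => ?_
  have := Finset.mem_range.1 hm
  rw [h.V_zero (a + (b + 1 - m)) (by omega), h.F_zero (a + (b + 1 - m)) (by omega), zero_mul,
    zero_mul, sub_zero]

/-- The Bezoutian of F and W may have degree 4 in x, with leading coefficient -W_5 F(z); the extra
term W_5 F(x)F(z) cancels exactly this. -/
theorem eval_flow_V_eq_zero {s : Gen → ℂ} (h : IsMumford l s) {a : ℕ} (ha : 4 ≤ a) (b : ℕ) :
    eval s (flow b (.V a)) = 0 := by
  simp only [flow, bezout, map_sum, map_sub, map_mul, map_add, eval_X]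
  -- For m < b the shifted index is at least 6, beyond the degrees of F and W.
  rw [Finset.sum_eq_single b]
  · rw [h.F_zero (a + (b + 1 - b)) (by omega)]
    obtain rfl | ha := ha.eq_or_lt
    · simp [h.monic]
    · rw [h.F_zero a ha, h.W_zero (a + (b + 1 - b)) (by omega)]
      simp
  · intro m hm hmb
    have := Finset.mem_range.1 hm
    rw [h.W_zero (a + (b + 1 - m)) (by omega), h.F_zero (a + (b + 1 - m)) (by omega), zero_mul,
      zero_mul, sub_zero]
  · simp

/-- Both sides are coefficients of polynomials of degree at most three, so agreement at the four x_i
suffices. There, F(x_i) = 0 differentiates to (∂F)(x_i) = -F'(x_i) ∂x_i, which is -y_i times the z^b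
coefficient of F(z)/(z - x_i). -/
theorem hasPderiv_F (h : JacobiInversion l U x y) {u : Fin 4 → ℂ} (hu : u ∈ U) {b : ℕ}
    (hb : b < 4) (a : ℕ) :
    HasPderiv (b + 1) (fun z => state l x y z (.F a)) (eval (state l x y u) (flow b (.F a))) u := by
  have hm := h.isMumford hu
  have hd : ∀ a, HasPderiv (b + 1) (fun z => state l x y z (.F a)) _ u :=
    fun a => ⟨h.differentiableAt_F hu a, rfl⟩
  have hd₀ : ∀ a, 4 ≤ a → pderiv (b + 1) (fun z => state l x y z (.F a)) u = 0 := by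
    intro a ha
    refine (hd a).unique ((HasPderiv.const _ (if a = 4 then 1 else 0) u).congr_of_eqOn h.isOpen
      hu fun z hz => ?_)
    split_ifs with h4
    · rw [h4, (h.isMumford hz).monic]
    · rw [(h.isMumford hz).F_zero _ (by omega)]
  refine (hd a).congr_deriv ?_
  by_cases ha : 4 ≤ a
  · rw [hd₀ a ha, eval_flow_F_eq_zero hm ha]
  · have key := eq_zero_of_sum_mul_pow (h.x_distinct u hu)
      (c := fun a => pderiv (b + 1) (fun z => state l x y z (.F a)) u -
        eval (state l x y u) (flow b (.F a))) (fun i => ?_) (not_le.1 ha)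
    · exact sub_eq_zero.1 key
    have h0 := (HasPderiv.const (b + 1) 0 u).congr_of_eqOn h.isOpen hu
      (ψ := fun z => ∑ a ∈ Finset.range 5, state l x y z (.F a) * x i z ^ a)
      fun z _ => sum_elemCoeff_mul_pow (fun i => x i z) i
    have h1 := h0.unique
      (HasPderiv.sum fun a _ => (hd a).mul ((h.hasPderiv_x hu (b + 1) i).pow a))
    have hF : ∑ a ∈ Finset.range 5, state l x y u (.F a) * x i u ^ a = 0 :=
      sum_elemCoeff_mul_pow (fun i => x i u) i
    have hV : ∑ a ∈ Finset.range 4, state l x y u (.V a) * x i u ^ a = y i u :=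
      sum_interpCoeff_mul_pow (h.x_distinct u hu) (fun i => y i u) i
    have hx := h.nodeDeriv_mul_pderiv hu hb i
    rw [nodeDeriv_eq] at hx
    -- Expressed through `state`, the relation survives the generalization to an arbitrary `s`, and
    -- only algebra is left.
    change (state l x y u (.F 1) + 2 * state l x y u (.F 2) * x i u +
      3 * state l x y u (.F 3) * x i u ^ 2 + 4 * x i u ^ 3) * _ =
      y i u * tail (fun a => state l x y u (.F a)) (b + 1) (x i u) at hx
    generalize state l x y u = s at *
    simp only [Finset.sum_range_succ, Finset.sum_range_zero, hd₀ 4 le_rfl, hm.monic] at h1 hF hV ⊢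
    simp only [flow, bezout, map_sum, map_sub, map_mul, eval_X]
    -- In each case the factors of `hF` and `hV` are the z^b coefficients of (V(z) - V(x))/(z - x)
    -- and (F(z) - F(x))/(z - x) at x = x_i, up to sign.
    interval_cases b
    · simp [Finset.sum_range_succ, tail, hm.monic, hm.V_zero] at hx h1 hF hV ⊢
      linear_combination -h1 - hx - (s (.V 1) + s (.V 2) * x i u + s (.V 3) * x i u ^ 2) * hF +
        (s (.F 1) + s (.F 2) * x i u + s (.F 3) * x i u ^ 2 + 1 * x i u ^ 3) * hV
    · simp [Finset.sum_range_succ, tail, hm.monic, hm.V_zero, hm.F_zero] at hx h1 hF hV ⊢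
      linear_combination -h1 - hx - (s (.V 2) + s (.V 3) * x i u) * hF +
        (s (.F 2) + s (.F 3) * x i u + 1 * x i u ^ 2) * hV
    · simp [Finset.sum_range_succ, tail, hm.monic, hm.V_zero, hm.F_zero] at hx h1 hF hV ⊢
      linear_combination -h1 - hx - (s (.V 3)) * hF +
        (s (.F 3) + 1 * x i u) * hV
    · simp [Finset.sum_range_succ, tail, hm.monic, hm.V_zero, hm.F_zero] at hx h1 hF hV ⊢
      linear_combination -h1 - hx - (0) * hF +
        (1) * hV

/-- Again a comparison at the four nodes. From V(x_i) = y_i, y_i² = f(x_i) and f = V² + F W one gets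
2 y_i (∂V)(x_i) = F'(x_i) W(x_i) ∂x_i, whence (∂V)(x_i) is W(x_i)/2 times the z^b coefficient of
F(z)/(z - x_i). -/
theorem hasPderiv_V (h : JacobiInversion l U x y) {u : Fin 4 → ℂ} (hu : u ∈ U) {b : ℕ}
    (hb : b < 4) (a : ℕ) :
    HasPderiv (b + 1) (fun z => state l x y z (.V a)) (eval (state l x y u) (flow b (.V a))) u := by
  have hm := h.isMumford hu
  have hd : ∀ a, HasPderiv (b + 1) (fun z => state l x y z (.V a)) _ u :=
    fun a => ⟨h.differentiableAt_V hu a, rfl⟩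
  refine (hd a).congr_deriv ?_
  by_cases ha : 4 ≤ a
  · rw [eval_flow_V_eq_zero hm ha]
    exact (hd a).unique ((HasPderiv.const _ 0 u).congr_of_eqOn h.isOpen hu
      fun z hz => (h.isMumford hz).V_zero _ ha)
  · have key := eq_zero_of_sum_mul_pow (h.x_distinct u hu)
      (c := fun a => pderiv (b + 1) (fun z => state l x y z (.V a)) u -
        eval (state l x y u) (flow b (.V a))) (fun i => ?_) (not_le.1 ha)
    · exact sub_eq_zero.1 key
    have hy := h.hasPderiv_y hu (b + 1) i
    have h1 := (hy.congr_of_eqOn h.isOpen hu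
      (ψ := fun z => ∑ a ∈ Finset.range 4, state l x y z (.V a) * x i z ^ a)
      fun z hz => sum_interpCoeff_mul_pow (h.x_distinct z hz) (fun i => y i z) i).unique
      (HasPderiv.sum fun a _ => (hd a).mul ((h.hasPderiv_x hu (b + 1) i).pow a))
    have h2 := ((hy.pow 2).congr_of_eqOn h.isOpen hu
      (ψ := fun z => ∑ k : Fin 10, l k * x i z ^ (k : ℕ))
      fun z hz => (h.on_curve z hz i).symm).unique
      (HasPderiv.sum fun k _ => ((h.hasPderiv_x hu (b + 1) i).pow k).const_mul (l k))
    have hF : ∑ a ∈ Finset.range 5, state l x y u (.F a) * x i u ^ a = 0 :=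
      sum_elemCoeff_mul_pow (fun i => x i u) i
    have hV : ∑ a ∈ Finset.range 4, state l x y u (.V a) * x i u ^ a = y i u :=
      sum_interpCoeff_mul_pow (h.x_distinct u hu) (fun i => y i u) i
    have hx := h.nodeDeriv_mul_pderiv hu hb i
    rw [nodeDeriv_eq] at hx
    change (state l x y u (.F 1) + 2 * state l x y u (.F 2) * x i u +
      3 * state l x y u (.F 3) * x i u ^ 2 + 4 * x i u ^ 3) * _ =
      y i u * tail (fun a => state l x y u (.F a)) (b + 1) (x i u) at hx
    -- This turns f' into (V² + F W)'; λ_0 drops out on differentiation.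
    obtain ⟨-, l1, l2, l3, l4, l5, l6, l7, l8, l9⟩ := hm.coeff_eq
    generalize state l x y u = s at *
    simp [Fin.sum_univ_succ] at h2
    simp only [l1, l2, l3, l4, l5, l6, l7, l8, l9] at h2
    -- The derivative of y_i is known only through 2 y_i ∂y_i = f'(x_i) ∂x_i, so the goal is
    -- multiplied by 2 y_i.
    have hy₀ := mul_ne_zero two_ne_zero (h.y_ne_zero u hu i)
    simp only [Finset.sum_range_succ, Finset.sum_range_zero, hm.monic] at h1 hF hV ⊢
    simp only [flow, bezout, map_sum, map_sub, map_add, map_mul, eval_X, eval_C]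
    interval_cases b
    · simp [Finset.sum_range_succ, tail, hm.monic] at hx h1 hF hV ⊢
      refine (mul_eq_zero.1 ?_).resolve_left hy₀
      linear_combination -(2 * y i u) * h1 + h2 +
        2 * (s (.V 1) + 2 * s (.V 2) * x i u + 3 * s (.V 3) * x i u ^ 2) *
          pderiv 1 (x i) u * hV +
        ((s (.W 1) + 2 * s (.W 2) * x i u + 3 * s (.W 3) * x i u ^ 2 + 4 * s (.W 4) * x i u ^ 3 +
          5 * s (.W 5) * x i u ^ 4) * pderiv 1 (x i) u - y i u * s (.W 5) * s (.F 0) +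
          y i u * (s (.W 1) + s (.W 2) * x i u + s (.W 3) * x i u ^ 2 + s (.W 4) * x i u ^ 3 + s (.W 5) * x i u ^ 4)) * hF +
        (s (.W 0) + s (.W 1) * x i u + s (.W 2) * x i u ^ 2 + s (.W 3) * x i u ^ 3 +
          s (.W 4) * x i u ^ 4 + s (.W 5) * x i u ^ 5) * hx
    · simp [Finset.sum_range_succ, tail, hm.monic, hm.F_zero] at hx h1 hF hV ⊢
      refine (mul_eq_zero.1 ?_).resolve_left hy₀
      linear_combination -(2 * y i u) * h1 + h2 +
        2 * (s (.V 1) + 2 * s (.V 2) * x i u + 3 * s (.V 3) * x i u ^ 2) *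
          pderiv 2 (x i) u * hV +
        ((s (.W 1) + 2 * s (.W 2) * x i u + 3 * s (.W 3) * x i u ^ 2 + 4 * s (.W 4) * x i u ^ 3 +
          5 * s (.W 5) * x i u ^ 4) * pderiv 2 (x i) u - y i u * s (.W 5) * s (.F 1) +
          y i u * (s (.W 2) + s (.W 3) * x i u + s (.W 4) * x i u ^ 2 + s (.W 5) * x i u ^ 3)) * hF +
        (s (.W 0) + s (.W 1) * x i u + s (.W 2) * x i u ^ 2 + s (.W 3) * x i u ^ 3 +
          s (.W 4) * x i u ^ 4 + s (.W 5) * x i u ^ 5) * hx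
    · simp [Finset.sum_range_succ, tail, hm.monic, hm.F_zero, hm.W_zero] at hx h1 hF hV ⊢
      refine (mul_eq_zero.1 ?_).resolve_left hy₀
      linear_combination -(2 * y i u) * h1 + h2 +
        2 * (s (.V 1) + 2 * s (.V 2) * x i u + 3 * s (.V 3) * x i u ^ 2) *
          pderiv 3 (x i) u * hV +
        ((s (.W 1) + 2 * s (.W 2) * x i u + 3 * s (.W 3) * x i u ^ 2 + 4 * s (.W 4) * x i u ^ 3 +
          5 * s (.W 5) * x i u ^ 4) * pderiv 3 (x i) u - y i u * s (.W 5) * s (.F 2) +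
          y i u * (s (.W 3) + s (.W 4) * x i u + s (.W 5) * x i u ^ 2)) * hF +
        (s (.W 0) + s (.W 1) * x i u + s (.W 2) * x i u ^ 2 + s (.W 3) * x i u ^ 3 +
          s (.W 4) * x i u ^ 4 + s (.W 5) * x i u ^ 5) * hx
    · simp [Finset.sum_range_succ, tail, hm.monic, hm.F_zero, hm.W_zero] at hx h1 hF hV ⊢
      refine (mul_eq_zero.1 ?_).resolve_left hy₀
      linear_combination -(2 * y i u) * h1 + h2 +
        2 * (s (.V 1) + 2 * s (.V 2) * x i u + 3 * s (.V 3) * x i u ^ 2) *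
          pderiv 4 (x i) u * hV +
        ((s (.W 1) + 2 * s (.W 2) * x i u + 3 * s (.W 3) * x i u ^ 2 + 4 * s (.W 4) * x i u ^ 3 +
          5 * s (.W 5) * x i u ^ 4) * pderiv 4 (x i) u - y i u * s (.W 5) * s (.F 3) +
          y i u * (s (.W 4) + s (.W 5) * x i u)) * hF +
        (s (.W 0) + s (.W 1) * x i u + s (.W 2) * x i u ^ 2 + s (.W 3) * x i u ^ 3 +
          s (.W 4) * x i u ^ 4 + s (.W 5) * x i u ^ 5) * hx

end JacobiInversion

namespace JacobiInversion

variable {l : Fin 10 → ℂ} {U : Set (Fin 4 → ℂ)} {x y : Fin 4 → (Fin 4 → ℂ) → ℂ}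

-- W is obtained from F, V and the constants λ_n by division, so its derivatives follow recursively
-- from W_5 down to W_0. They match `flow` because the three vector fields preserve V² + F W.
set_option linter.unusedSimpArgs false in
set_option maxHeartbeats 1000000 in
theorem hasPderiv_W (h : JacobiInversion l U x y) {u : Fin 4 → ℂ} (hu : u ∈ U) {b : ℕ}
    (hb : b < 4) (a : ℕ) :
    HasPderiv (b + 1) (fun z => state l x y z (.W a)) (eval (state l x y u) (flow b (.W a))) u := by
  have hm := h.isMumford hu
  have hF := h.hasPderiv_F hu hb
  have hV := h.hasPderiv_V hu hb
  have h5 : HasPderiv (b + 1) (fun z => state l x y z (.W 5))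
      (eval (state l x y u) (flow b (.W 5))) u := by
    refine ((HasPderiv.const (b + 1) (l 9) u).congr_of_eqOn h.isOpen hu
      fun z _ => (rfl : state l x y z (.W 5) = l 9)).congr_deriv ?_
    interval_cases b <;>
      simp only [flow, bezout, Finset.sum_range_succ, Finset.sum_range_zero, Nat.reduceAdd,
        Nat.reduceSub, map_add, map_sub, map_mul, map_zero, eval_X, eval_C, hm.monic, hm.F_zero,
        hm.V_zero, hm.W_zero, le_refl, Nat.reduceLeDiff] <;> ring
  have h4 : HasPderiv (b + 1) (fun z => state l x y z (.W 4))
      (eval (state l x y u) (flow b (.W 4))) u := by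
    refine (((HasPderiv.const (b + 1) (l 8) u).sub
      ((hF 3).mul h5)).congr_of_eqOn h.isOpen hu
      fun z _ => (rfl : state l x y z (.W 4) = l 8 -
        state l x y z (.F 3) * state l x y z (.W 5))).congr_deriv ?_
    interval_cases b <;>
      simp only [flow, bezout, Finset.sum_range_succ, Finset.sum_range_zero, Nat.reduceAdd,
        Nat.reduceSub, map_add, map_sub, map_mul, map_zero, eval_X, eval_C, hm.monic, hm.F_zero,
        hm.V_zero, hm.W_zero, le_refl, Nat.reduceLeDiff] <;> ring
  have h3 : HasPderiv (b + 1) (fun z => state l x y z (.W 3))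
      (eval (state l x y u) (flow b (.W 3))) u := by
    refine ((((HasPderiv.const (b + 1) (l 7) u).sub
      ((hF 3).mul h4)).sub
      ((hF 2).mul h5)).congr_of_eqOn h.isOpen hu
      fun z _ => (rfl : state l x y z (.W 3) = l 7 -
        state l x y z (.F 3) * state l x y z (.W 4) -
        state l x y z (.F 2) * state l x y z (.W 5))).congr_deriv ?_
    interval_cases b <;>
      simp only [flow, bezout, Finset.sum_range_succ, Finset.sum_range_zero, Nat.reduceAdd,
        Nat.reduceSub, map_add, map_sub, map_mul, map_zero, eval_X, eval_C, hm.monic, hm.F_zero,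
        hm.V_zero, hm.W_zero, le_refl, Nat.reduceLeDiff] <;> ring
  have h2 : HasPderiv (b + 1) (fun z => state l x y z (.W 2))
      (eval (state l x y u) (flow b (.W 2))) u := by
    refine ((((((HasPderiv.const (b + 1) (l 6) u).sub
      ((hV 3).mul (hV 3))).sub
      ((hF 3).mul h3)).sub
      ((hF 2).mul h4)).sub
      ((hF 1).mul h5)).congr_of_eqOn h.isOpen hu
      fun z _ => (rfl : state l x y z (.W 2) = l 6 - state l x y z (.V 3) * state l x y z (.V 3) -
        state l x y z (.F 3) * state l x y z (.W 3) -
        state l x y z (.F 2) * state l x y z (.W 4) -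
        state l x y z (.F 1) * state l x y z (.W 5))).congr_deriv ?_
    interval_cases b <;>
      simp only [flow, bezout, Finset.sum_range_succ, Finset.sum_range_zero, Nat.reduceAdd,
        Nat.reduceSub, map_add, map_sub, map_mul, map_zero, eval_X, eval_C, hm.monic, hm.F_zero,
        hm.V_zero, hm.W_zero, le_refl, Nat.reduceLeDiff] <;> ring
  have h1 : HasPderiv (b + 1) (fun z => state l x y z (.W 1))
      (eval (state l x y u) (flow b (.W 1))) u := by
    refine (((((((HasPderiv.const (b + 1) (l 5) u).sub
      (((hV 2).mul (hV 3)).const_mul 2)).sub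
      ((hF 3).mul h2)).sub
      ((hF 2).mul h3)).sub
      ((hF 1).mul h4)).sub
      ((hF 0).mul h5)).congr_of_eqOn h.isOpen hu
      fun z _ => (rfl : state l x y z (.W 1) = l 5 - 2 * (state l x y z (.V 2) * state l x y z (.V 3)) -
        state l x y z (.F 3) * state l x y z (.W 2) -
        state l x y z (.F 2) * state l x y z (.W 3) -
        state l x y z (.F 1) * state l x y z (.W 4) -
        state l x y z (.F 0) * state l x y z (.W 5))).congr_deriv ?_
    interval_cases b <;>
      simp only [flow, bezout, Finset.sum_range_succ, Finset.sum_range_zero, Nat.reduceAdd,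
        Nat.reduceSub, map_add, map_sub, map_mul, map_zero, eval_X, eval_C, hm.monic, hm.F_zero,
        hm.V_zero, hm.W_zero, le_refl, Nat.reduceLeDiff] <;> ring
  have h0 : HasPderiv (b + 1) (fun z => state l x y z (.W 0))
      (eval (state l x y u) (flow b (.W 0))) u := by
    refine ((((((((HasPderiv.const (b + 1) (l 4) u).sub
      (((hV 1).mul (hV 3)).const_mul 2)).sub
      ((hV 2).mul (hV 2))).sub
      ((hF 3).mul h1)).sub
      ((hF 2).mul h2)).sub
      ((hF 1).mul h3)).sub
      ((hF 0).mul h4)).congr_of_eqOn h.isOpen hu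
      fun z _ => (rfl : state l x y z (.W 0) = l 4 - 2 * (state l x y z (.V 1) * state l x y z (.V 3)) - state l x y z (.V 2) * state l x y z (.V 2) -
        state l x y z (.F 3) * state l x y z (.W 1) -
        state l x y z (.F 2) * state l x y z (.W 2) -
        state l x y z (.F 1) * state l x y z (.W 3) -
        state l x y z (.F 0) * state l x y z (.W 4))).congr_deriv ?_
    interval_cases b <;>
      simp only [flow, bezout, Finset.sum_range_succ, Finset.sum_range_zero, Nat.reduceAdd,
        Nat.reduceSub, map_add, map_sub, map_mul, map_zero, eval_X, eval_C, hm.monic, hm.F_zero,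
        hm.V_zero, hm.W_zero, le_refl, Nat.reduceLeDiff] <;> ring
  match a with
  | 0 => exact h0
  | 1 => exact h1
  | 2 => exact h2
  | 3 => exact h3
  | 4 => exact h4
  | 5 => exact h5
  | a + 6 =>
    refine ((HasPderiv.const _ 0 u).congr_of_eqOn h.isOpen hu fun z hz =>
      (h.isMumford hz).W_zero _ (by omega)).congr_deriv ?_
    simp only [flow, bezout, map_sum, map_sub, map_mul, eval_X]
    rw [hm.V_zero (a + 6) (by omega), Finset.sum_eq_zero fun m _ => ?_]
    · ring
    · rw [hm.W_zero (a + 6 + (b + 1 - m)) (by omega), hm.V_zero (a + 6 + (b + 1 - m)) (by omega)]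
      ring

theorem hasPderiv_state (h : JacobiInversion l U x y) {u : Fin 4 → ℂ} (hu : u ∈ U) {b : ℕ}
    (hb : b < 4) (g : Gen) :
    HasPderiv (b + 1) (fun z => state l x y z g) (eval (state l x y u) (flow b g)) u :=
  match g with
  | .F a => h.hasPderiv_F hu hb a
  | .V a => h.hasPderiv_V hu hb a
  | .W a => h.hasPderiv_W hu hb a

/-! ### Identification of ℘_{jk} with quadratic polynomials in F, V, W -/

/-- The algebraic parts of the functions `ζ_j` in terms of the coefficients of `F` and `V`. -/
noncomputable def zetaPoly : ℕ → MvPolynomial Gen ℂ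
  | 1 => C 3 * X (.V 1) - X (.F 3) * X (.V 2) + (X (.F 3) * X (.F 3) - C 2 * X (.F 2)) * X (.V 3)
  | 2 => C 2 * X (.V 2) - X (.F 3) * X (.V 3)
  | 3 => X (.V 3)
  | _ => 0

theorem zetaAlgPart_eq (l : Fin 10 → ℂ) (x y : Fin 4 → (Fin 4 → ℂ) → ℂ) {j : ℕ}
    (hj : j ∈ Finset.Icc 1 4) (u : Fin 4 → ℂ) :
    zetaAlgPart x y j u = eval (state l x y u) (zetaPoly j) := by
  rw [Finset.mem_Icc] at hj
  obtain ⟨_, _⟩ := hj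
  set X : Fin 4 → ℂ := fun i => x i u with hX
  have hz : zetaAlgPart x y j u = ∑ i, y i u * chiOmit j X i / nodeDeriv X i := rfl
  rw [hz]
  interval_cases j
  · simp only [(chiOmit_eq X _).2.2.2, zetaPoly, map_add, map_sub, map_mul, eval_X, eval_C, state,
      mumford, interpCoeff, Finset.mul_sum, ← Finset.sum_sub_distrib, ← Finset.sum_add_distrib]
    exact Finset.sum_congr rfl fun i _ => by ring
  · simp only [(chiOmit_eq X _).2.2.1, zetaPoly, map_sub, map_mul, eval_X, eval_C, state,
      mumford, interpCoeff, Finset.mul_sum, ← Finset.sum_sub_distrib]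
    exact Finset.sum_congr rfl fun i _ => by ring
  · simp only [(chiOmit_eq X _).2.1, zetaPoly, eval_X, state, mumford, interpCoeff]
    rfl
  · simp [(chiOmit_eq X _).1, zetaPoly]

-- The first part of d(-ζ_j) is a λ-combination of the power sums `r`, which Jacobi's equations and
-- F(x_i) = 0 determine; the second is the derivative of `zetaPoly` along the flow. Eliminating the
-- λ_n leaves a polynomial identity.
set_option linter.unusedSimpArgs false in
set_option maxHeartbeats 1000000 in
theorem wp_eq (h : JacobiInversion l U x y) {u : Fin 4 → ℂ} (hu : u ∈ U) {j k : ℕ}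
    (hj : j ∈ Finset.Icc 1 4) (hk : k ∈ Finset.Icc 1 4) :
    wp l x y j k u = eval (state l x y u) (wpPoly j k) := by
  have hm := h.isMumford hu
  obtain ⟨b, rfl⟩ : ∃ b, k = b + 1 := ⟨k - 1, by have := Finset.mem_Icc.1 hk; omega⟩
  have hb : b < 4 := by have := Finset.mem_Icc.1 hk; omega
  have hz := (((HasPderiv.eval (h.hasPderiv_state hu hb) (zetaPoly j)).congr_of_eqOn h.isOpen hu
    fun z _ => zetaAlgPart_eq l x y hj z)).2
  set r : ℕ → ℂ := fun n => ∑ i, x i u ^ n * (pderiv (b + 1) (x i) u / y i u) with hr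
  have hsum : wp l x y j (b + 1) u = 1 / 4 * ∑ n ∈ Finset.Icc j (9 - j),
      ((n : ℂ) + 1 - (j : ℂ)) * coeffExt l (n + 1 + j) * r n -
        1 / 2 * pderiv (b + 1) (zetaAlgPart x y j) u := by
    simp only [hr, Finset.mul_sum (Finset.univ : Finset (Fin 4))]
    rw [Finset.sum_comm]
    simp only [wp, negZetaDiff, pderiv]
    congr 2
    refine Finset.sum_congr rfl fun i _ => ?_
    rw [Finset.mul_sum]
    exact Finset.sum_congr rfl fun n _ => by ring
  have r0 : r 0 = _ := h.sum_pow_mul hu (b := b) (show 0 < 4 by norm_num)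
  have r1 : r 1 = _ := h.sum_pow_mul hu (b := b) (show 1 < 4 by norm_num)
  have r2 : r 2 = _ := h.sum_pow_mul hu (b := b) (show 2 < 4 by norm_num)
  have r3 : r 3 = _ := h.sum_pow_mul hu (b := b) (show 3 < 4 by norm_num)
  -- The recursion stops at `r 7`: the last summand, n = 9 - j, carries λ_10 = 0, so `r 8` never
  -- contributes.
  have r4 : r 4 = _ := sum_pow_add_four_mul (l := l) u (b + 1) 0
  have r5 : r 5 = _ := sum_pow_add_four_mul (l := l) u (b + 1) 1
  have r6 : r 6 = _ := sum_pow_add_four_mul (l := l) u (b + 1) 2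
  have r7 : r 7 = _ := sum_pow_add_four_mul (l := l) u (b + 1) 3
  rw [hsum, hz]
  clear hz hsum
  change r 4 = -(_ * r 3 + _ * r 2 + _ * r 1 + _ * r 0) at r4
  change r 5 = -(_ * r 4 + _ * r 3 + _ * r 2 + _ * r 1) at r5
  change r 6 = -(_ * r 5 + _ * r 4 + _ * r 3 + _ * r 2) at r6
  change r 7 = -(_ * r 6 + _ * r 5 + _ * r 4 + _ * r 3) at r7
  obtain ⟨-, -, l2, l3, l4, l5, l6, l7, l8, l9⟩ := hm.coeff_eq
  generalize state l x y u = s at *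
  clear_value r
  rw [Finset.mem_Icc] at hj
  obtain ⟨_, _⟩ := hj
  interval_cases j
  · rw [show Finset.Icc 1 (9 - 1) = {1, 2, 3, 4, 5, 6, 7, 8} from by decide]
    interval_cases b <;>
      simp [zetaPoly, wpPoly, flow, bezout, Finset.sum_range_succ, hm.monic, hm.F_zero, hm.V_zero,
        hm.W_zero, coeffExt, r7, r6, r5, r4, r3, r2, r1, r0, l2, l3, l4, l5, l6, l7, l8, l9] <;>
      ring
  · rw [show Finset.Icc 2 (9 - 2) = {2, 3, 4, 5, 6, 7} from by decide]
    interval_cases b <;>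
      simp [zetaPoly, wpPoly, flow, bezout, Finset.sum_range_succ, hm.monic, hm.F_zero, hm.V_zero,
        hm.W_zero, coeffExt, r7, r6, r5, r4, r3, r2, r1, r0, l2, l3, l4, l5, l6, l7, l8, l9] <;>
      ring
  · rw [show Finset.Icc 3 (9 - 3) = {3, 4, 5, 6} from by decide]
    interval_cases b <;>
      simp [zetaPoly, wpPoly, flow, bezout, Finset.sum_range_succ, hm.monic, hm.F_zero, hm.V_zero,
        hm.W_zero, coeffExt, r6, r5, r4, r3, r2, r1, r0, l2, l3, l4, l5, l6, l7, l8, l9] <;>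
      ring
  · rw [show Finset.Icc 4 (9 - 4) = {4, 5} from by decide]
    interval_cases b <;>
      simp [zetaPoly, wpPoly, flow, bezout, Finset.sum_range_succ, hm.monic, hm.F_zero, hm.V_zero,
        hm.W_zero, coeffExt, r5, r4, r3, r2, r1, r0, l2, l3, l4, l5, l6, l7, l8, l9] <;>
      ring

end JacobiInversion

/-! ### Transfer to ℘_{jk} and analytic continuation -/

/-- The families are indexed by all of ℕ, but only indices 1 to 4 occur in the equations; nothing is
known of the others. -/
theorem Equations.congr {l : Fin 10 → ℂ} {p p' : ℕ → ℕ → ℂ} {q q' : ℕ → ℕ → ℕ → ℕ → ℂ}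
    (h : Equations l p q)
    (hp : ∀ j ∈ Finset.Icc 1 4, ∀ k ∈ Finset.Icc 1 4, p j k = p' j k)
    (hq : ∀ i ∈ Finset.Icc 1 4, ∀ j ∈ Finset.Icc 1 4, ∀ k ∈ Finset.Icc 1 4,
      ∀ m ∈ Finset.Icc 1 4, q i j k m = q' i j k m) : Equations l p' q' := by
  have h1 : 1 ∈ Finset.Icc 1 4 := by decide
  have h2 : 2 ∈ Finset.Icc 1 4 := by decide
  have h3 : 3 ∈ Finset.Icc 1 4 := by decide
  have h4 : 4 ∈ Finset.Icc 1 4 := by decide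
  obtain ⟨e1, e2, e3, e4, e5, e6, e7, e8, e9, e10, e11, e12, e13, e14, e15, e16, e17, e18, e19, e20,
    e21, e22, e23, e24, e25, e26, e27, e28, e29, e30, e31, e32, e33, e34, e35⟩ := h
  simp only [Delta2, Delta3, Delta4, Delta5, Delta7, hp, hq, h1, h2, h3, h4]
    at e1 e2 e3 e4 e5 e6 e7 e8 e9 e10 e11 e12 e13 e14 e15 e16 e17 e18 e19 e20 e21 e22 e23 e24 e25
      e26 e27 e28 e29 e30 e31 e32 e33 e34 e35
  exact ⟨e1, e2, e3, e4, e5, e6, e7, e8, e9, e10, e11, e12, e13, e14, e15, e16, e17, e18, e19, e20,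
    e21, e22, e23, e24, e25, e26, e27, e28, e29, e30, e31, e32, e33, e34, e35⟩

/-- Analytic functions on a connected open set satisfying the equations on a nonempty open subset
satisfy them everywhere. -/
theorem Equations.of_preconnected {l : Fin 10 → ℂ} {V Ω : Set (Fin 4 → ℂ)}
    {p : ℕ → ℕ → (Fin 4 → ℂ) → ℂ} {q : ℕ → ℕ → ℕ → ℕ → (Fin 4 → ℂ) → ℂ}
    (hV : IsOpen V) (hne : V.Nonempty) (hVΩ : V ⊆ Ω) (hΩ : IsPreconnected Ω)
    (hp : ∀ j k, AnalyticOnNhd ℂ (p j k) Ω) (hq : ∀ i j k m, AnalyticOnNhd ℂ (q i j k m) Ω)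
    (h : ∀ u ∈ V, Equations l (fun j k => p j k u) (fun i j k m => q i j k m u)) :
    ∀ u ∈ Ω, Equations l (fun j k => p j k u) (fun i j k m => q i j k m u) := by
  obtain ⟨v, hv⟩ := hne
  have key : ∀ {A B : (Fin 4 → ℂ) → ℂ}, (∀ u ∈ V, A u = B u) → AnalyticOnNhd ℂ A Ω →
      AnalyticOnNhd ℂ B Ω → ∀ u ∈ Ω, A u = B u := fun hAB hA hB =>
    hA.eqOn_of_preconnected_of_eventuallyEq hB hΩ (hVΩ hv)
      (Filter.eventuallyEq_of_mem (hV.mem_nhds hv) hAB)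
  have hp' : ∀ u ∈ Ω, ∀ j k, AnalyticAt ℂ (p j k) u := fun u hu j k => hp j k u hu
  have hq' : ∀ u ∈ Ω, ∀ i j k m, AnalyticAt ℂ (q i j k m) u := fun u hu i j k m => hq i j k m u hu
  intro u hu
  constructor
  · refine key (fun u hu => (h u hu).eq1) (fun z hz => ?_) (fun z hz => ?_) u hu <;>
      have hp := hp' z hz <;> have hq := hq' z hz <;>
      fun_prop [Delta2, Delta3, Delta4, Delta5, Delta7]
  · refine key (fun u hu => (h u hu).eq2) (fun z hz => ?_) (fun z hz => ?_) u hu <;>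
      have hp := hp' z hz <;> have hq := hq' z hz <;>
      fun_prop [Delta2, Delta3, Delta4, Delta5, Delta7]
  · refine key (fun u hu => (h u hu).eq3) (fun z hz => ?_) (fun z hz => ?_) u hu <;>
      have hp := hp' z hz <;> have hq := hq' z hz <;>
      fun_prop [Delta2, Delta3, Delta4, Delta5, Delta7]
  · refine key (fun u hu => (h u hu).eq4) (fun z hz => ?_) (fun z hz => ?_) u hu <;>
      have hp := hp' z hz <;> have hq := hq' z hz <;>
      fun_prop [Delta2, Delta3, Delta4, Delta5, Delta7]
  · refine key (fun u hu => (h u hu).eq5) (fun z hz => ?_) (fun z hz => ?_) u hu <;>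
      have hp := hp' z hz <;> have hq := hq' z hz <;>
      fun_prop [Delta2, Delta3, Delta4, Delta5, Delta7]
  · refine key (fun u hu => (h u hu).eq6) (fun z hz => ?_) (fun z hz => ?_) u hu <;>
      have hp := hp' z hz <;> have hq := hq' z hz <;>
      fun_prop [Delta2, Delta3, Delta4, Delta5, Delta7]
  · refine key (fun u hu => (h u hu).eq7) (fun z hz => ?_) (fun z hz => ?_) u hu <;>
      have hp := hp' z hz <;> have hq := hq' z hz <;>
      fun_prop [Delta2, Delta3, Delta4, Delta5, Delta7]
  · refine key (fun u hu => (h u hu).eq8) (fun z hz => ?_) (fun z hz => ?_) u hu <;>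
      have hp := hp' z hz <;> have hq := hq' z hz <;>
      fun_prop [Delta2, Delta3, Delta4, Delta5, Delta7]
  · refine key (fun u hu => (h u hu).eq9) (fun z hz => ?_) (fun z hz => ?_) u hu <;>
      have hp := hp' z hz <;> have hq := hq' z hz <;>
      fun_prop [Delta2, Delta3, Delta4, Delta5, Delta7]
  · refine key (fun u hu => (h u hu).eq10) (fun z hz => ?_) (fun z hz => ?_) u hu <;>
      have hp := hp' z hz <;> have hq := hq' z hz <;>
      fun_prop [Delta2, Delta3, Delta4, Delta5, Delta7]
  · refine key (fun u hu => (h u hu).eq11) (fun z hz => ?_) (fun z hz => ?_) u hu <;>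
      have hp := hp' z hz <;> have hq := hq' z hz <;>
      fun_prop [Delta2, Delta3, Delta4, Delta5, Delta7]
  · refine key (fun u hu => (h u hu).eq12) (fun z hz => ?_) (fun z hz => ?_) u hu <;>
      have hp := hp' z hz <;> have hq := hq' z hz <;>
      fun_prop [Delta2, Delta3, Delta4, Delta5, Delta7]
  · refine key (fun u hu => (h u hu).eq13) (fun z hz => ?_) (fun z hz => ?_) u hu <;>
      have hp := hp' z hz <;> have hq := hq' z hz <;>
      fun_prop [Delta2, Delta3, Delta4, Delta5, Delta7]
  · refine key (fun u hu => (h u hu).eq14) (fun z hz => ?_) (fun z hz => ?_) u hu <;>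
      have hp := hp' z hz <;> have hq := hq' z hz <;>
      fun_prop [Delta2, Delta3, Delta4, Delta5, Delta7]
  · refine key (fun u hu => (h u hu).eq15) (fun z hz => ?_) (fun z hz => ?_) u hu <;>
      have hp := hp' z hz <;> have hq := hq' z hz <;>
      fun_prop [Delta2, Delta3, Delta4, Delta5, Delta7]
  · refine key (fun u hu => (h u hu).eq16) (fun z hz => ?_) (fun z hz => ?_) u hu <;>
      have hp := hp' z hz <;> have hq := hq' z hz <;>
      fun_prop [Delta2, Delta3, Delta4, Delta5, Delta7]
  · refine key (fun u hu => (h u hu).eq17) (fun z hz => ?_) (fun z hz => ?_) u hu <;>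
      have hp := hp' z hz <;> have hq := hq' z hz <;>
      fun_prop [Delta2, Delta3, Delta4, Delta5, Delta7]
  · refine key (fun u hu => (h u hu).eq18) (fun z hz => ?_) (fun z hz => ?_) u hu <;>
      have hp := hp' z hz <;> have hq := hq' z hz <;>
      fun_prop [Delta2, Delta3, Delta4, Delta5, Delta7]
  · refine key (fun u hu => (h u hu).eq19) (fun z hz => ?_) (fun z hz => ?_) u hu <;>
      have hp := hp' z hz <;> have hq := hq' z hz <;>
      fun_prop [Delta2, Delta3, Delta4, Delta5, Delta7]
  · refine key (fun u hu => (h u hu).eq20) (fun z hz => ?_) (fun z hz => ?_) u hu <;>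
      have hp := hp' z hz <;> have hq := hq' z hz <;>
      fun_prop [Delta2, Delta3, Delta4, Delta5, Delta7]
  · refine key (fun u hu => (h u hu).eq21) (fun z hz => ?_) (fun z hz => ?_) u hu <;>
      have hp := hp' z hz <;> have hq := hq' z hz <;>
      fun_prop [Delta2, Delta3, Delta4, Delta5, Delta7]
  · refine key (fun u hu => (h u hu).eq22) (fun z hz => ?_) (fun z hz => ?_) u hu <;>
      have hp := hp' z hz <;> have hq := hq' z hz <;>
      fun_prop [Delta2, Delta3, Delta4, Delta5, Delta7]
  · refine key (fun u hu => (h u hu).eq23) (fun z hz => ?_) (fun z hz => ?_) u hu <;>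
      have hp := hp' z hz <;> have hq := hq' z hz <;>
      fun_prop [Delta2, Delta3, Delta4, Delta5, Delta7]
  · refine key (fun u hu => (h u hu).eq24) (fun z hz => ?_) (fun z hz => ?_) u hu <;>
      have hp := hp' z hz <;> have hq := hq' z hz <;>
      fun_prop [Delta2, Delta3, Delta4, Delta5, Delta7]
  · refine key (fun u hu => (h u hu).eq25) (fun z hz => ?_) (fun z hz => ?_) u hu <;>
      have hp := hp' z hz <;> have hq := hq' z hz <;>
      fun_prop [Delta2, Delta3, Delta4, Delta5, Delta7]
  · refine key (fun u hu => (h u hu).eq26) (fun z hz => ?_) (fun z hz => ?_) u hu <;>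
      have hp := hp' z hz <;> have hq := hq' z hz <;>
      fun_prop [Delta2, Delta3, Delta4, Delta5, Delta7]
  · refine key (fun u hu => (h u hu).eq27) (fun z hz => ?_) (fun z hz => ?_) u hu <;>
      have hp := hp' z hz <;> have hq := hq' z hz <;>
      fun_prop [Delta2, Delta3, Delta4, Delta5, Delta7]
  · refine key (fun u hu => (h u hu).eq28) (fun z hz => ?_) (fun z hz => ?_) u hu <;>
      have hp := hp' z hz <;> have hq := hq' z hz <;>
      fun_prop [Delta2, Delta3, Delta4, Delta5, Delta7]
  · refine key (fun u hu => (h u hu).eq29) (fun z hz => ?_) (fun z hz => ?_) u hu <;>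
      have hp := hp' z hz <;> have hq := hq' z hz <;>
      fun_prop [Delta2, Delta3, Delta4, Delta5, Delta7]
  · refine key (fun u hu => (h u hu).eq30) (fun z hz => ?_) (fun z hz => ?_) u hu <;>
      have hp := hp' z hz <;> have hq := hq' z hz <;>
      fun_prop [Delta2, Delta3, Delta4, Delta5, Delta7]
  · refine key (fun u hu => (h u hu).eq31) (fun z hz => ?_) (fun z hz => ?_) u hu <;>
      have hp := hp' z hz <;> have hq := hq' z hz <;>
      fun_prop [Delta2, Delta3, Delta4, Delta5, Delta7]
  · refine key (fun u hu => (h u hu).eq32) (fun z hz => ?_) (fun z hz => ?_) u hu <;>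
      have hp := hp' z hz <;> have hq := hq' z hz <;>
      fun_prop [Delta2, Delta3, Delta4, Delta5, Delta7]
  · refine key (fun u hu => (h u hu).eq33) (fun z hz => ?_) (fun z hz => ?_) u hu <;>
      have hp := hp' z hz <;> have hq := hq' z hz <;>
      fun_prop [Delta2, Delta3, Delta4, Delta5, Delta7]
  · refine key (fun u hu => (h u hu).eq34) (fun z hz => ?_) (fun z hz => ?_) u hu <;>
      have hp := hp' z hz <;> have hq := hq' z hz <;>
      fun_prop [Delta2, Delta3, Delta4, Delta5, Delta7]
  · refine key (fun u hu => (h u hu).eq35) (fun z hz => ?_) (fun z hz => ?_) u hu <;>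
      have hp := hp' z hz <;> have hq := hq' z hz <;>
      fun_prop [Delta2, Delta3, Delta4, Delta5, Delta7]

/-- The polynomial formula for ℘_{ij} holds on all of the open set U, so it may be differentiated
twice; ∂/∂u_k acts as `flow (k - 1)`. -/
theorem JacobiInversion.fourIndex_eq {l : Fin 10 → ℂ} {U : Set (Fin 4 → ℂ)}
    {x y : Fin 4 → (Fin 4 → ℂ) → ℂ} (h : JacobiInversion l U x y) {u : Fin 4 → ℂ} (hu : u ∈ U)
    {i j k m : ℕ} (hi : i ∈ Finset.Icc 1 4) (hj : j ∈ Finset.Icc 1 4) (hk : k ∈ Finset.Icc 1 4)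
    (hm : m ∈ Finset.Icc 1 4) :
    fourIndex (wp l x y) i j k m u = eval (state l x y u) (wpPoly₄ i j k m) := by
  have key : ∀ {k}, k ∈ Finset.Icc 1 4 → ∀ (p : MvPolynomial Gen ℂ), ∀ z ∈ U,
      HasPderiv k (fun z => eval (state l x y z) p)
        (eval (state l x y z) (MvPolynomial.mkDerivation ℂ (flow (k - 1)) p)) z := by
    intro k hk p z hz
    obtain ⟨b, rfl⟩ : ∃ b, k = b + 1 := ⟨k - 1, by have := Finset.mem_Icc.1 hk; omega⟩
    exact HasPderiv.eval (h.hasPderiv_state hz (by have := Finset.mem_Icc.1 hk; omega)) p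
  refine ((key hm _ u hu).congr_of_eqOn h.isOpen hu fun z hz => ?_).2
  exact ((key hk _ z hz).congr_of_eqOn h.isOpen hz fun w hw => h.wp_eq hw hi hj).2

theorem JacobiInversion.equations {l : Fin 10 → ℂ} {U : Set (Fin 4 → ℂ)}
    {x y : Fin 4 → (Fin 4 → ℂ) → ℂ} (h : JacobiInversion l U x y) {u : Fin 4 → ℂ} (hu : u ∈ U) :
    Equations l (fun j k => wp l x y j k u)
      (fun i j k m => fourIndex (wp l x y) i j k m u) :=
  (equations_of_isMumford (h.isMumford hu)).congr (fun _ hj _ hk => (h.wp_eq hu hj hk).symm)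
    fun _ hi _ hj _ hk _ hm => (h.fourIndex_eq hu hi hj hk hm).symm

theorem analyticOnNhd_pderiv {φ : (Fin 4 → ℂ) → ℂ} {Ω : Set (Fin 4 → ℂ)}
    (hφ : AnalyticOnNhd ℂ φ Ω) (k : ℕ) : AnalyticOnNhd ℂ (pderiv k φ) Ω := fun u hu =>
  (ContinuousLinearMap.analyticAt (ContinuousLinearMap.apply ℂ ℂ (unitVec k)) _).comp
    (hφ u hu).fderiv

theorem pderiv_congr {φ ψ : (Fin 4 → ℂ) → ℂ} {V : Set (Fin 4 → ℂ)} (hV : IsOpen V)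
    (h : ∀ u ∈ V, φ u = ψ u) (k : ℕ) : ∀ u ∈ V, pderiv k φ u = pderiv k ψ u := fun u hu => by
  rw [pderiv, pderiv, (Filter.eventuallyEq_of_mem (hV.mem_nhds hu) h).fderiv_eq]

end GenusFour

theorem mainTheorem2 (l : Fin 10 → ℂ) (U : Set (Fin 4 → ℂ)) (x y : Fin 4 → (Fin 4 → ℂ) → ℂ)
    (hxy : GenusFour.JacobiInversion l U x y) :
    (∀ u ∈ U,
      (∀ j ∈ Finset.Icc 1 4, ∀ k ∈ Finset.Icc 1 4,
        GenusFour.wp l x y j k u = GenusFour.wp l x y k j u) ∧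
      GenusFour.Equations l (fun j k => GenusFour.wp l x y j k u)
        (fun i j k m => GenusFour.fourIndex (GenusFour.wp l x y) i j k m u)) ∧
    (∀ (Ω : Set (Fin 4 → ℂ)) (P : ℕ → ℕ → (Fin 4 → ℂ) → ℂ),
      IsOpen Ω → IsPreconnected Ω → (U ∩ Ω).Nonempty →
      (∀ j ∈ Finset.Icc 1 4, ∀ k ∈ Finset.Icc 1 4, AnalyticOnNhd ℂ (P j k) Ω) →
      (∀ j ∈ Finset.Icc 1 4, ∀ k ∈ Finset.Icc 1 4, ∀ u ∈ U ∩ Ω,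
        P j k u = GenusFour.wp l x y j k u) →
      ∀ u ∈ Ω,
        (∀ j ∈ Finset.Icc 1 4, ∀ k ∈ Finset.Icc 1 4, P j k u = P k j u) ∧
        GenusFour.Equations l (fun j k => P j k u)
          (fun i j k m => GenusFour.fourIndex P i j k m u)) := by
  have hsymm : ∀ u ∈ U, ∀ j ∈ Finset.Icc 1 4, ∀ k ∈ Finset.Icc 1 4,
      GenusFour.wp l x y j k u = GenusFour.wp l x y k j u := fun u hu j hj k hk => by
    rw [hxy.wp_eq hu hj hk, hxy.wp_eq hu hk hj, GenusFour.wpPoly_comm j k hj hk]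
  refine ⟨fun u hu => ⟨hsymm u hu, hxy.equations hu⟩, fun Ω P hΩ hc hne hP hPwp u hu => ?_⟩
  have hV : IsOpen (U ∩ Ω) := hxy.isOpen.inter hΩ
  constructor
  · intro j hj k hk
    obtain ⟨v, hv⟩ := hne
    refine (hP j hj k hk).eqOn_of_preconnected_of_eventuallyEq (hP k hk j hj) hc hv.2
      (Filter.eventuallyEq_of_mem (hV.mem_nhds hv) fun z hz => ?_) hu
    rw [hPwp j hj k hk z hz, hPwp k hk j hj z hz, hsymm z hz.1 j hj k hk]
  -- Replace the functions `P j k` with irrelevant indices by zero.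
  classical
  let P' : ℕ → ℕ → (Fin 4 → ℂ) → ℂ := fun j k =>
    if j ∈ Finset.Icc 1 4 ∧ k ∈ Finset.Icc 1 4 then P j k else 0
  have hP'P : ∀ j ∈ Finset.Icc 1 4, ∀ k ∈ Finset.Icc 1 4, P' j k = P j k :=
    fun j hj k hk => if_pos ⟨hj, hk⟩
  have hP' : ∀ j k, AnalyticOnNhd ℂ (P' j k) Ω := fun j k => by
    by_cases hjk : j ∈ Finset.Icc 1 4 ∧ k ∈ Finset.Icc 1 4
    · rw [hP'P j hjk.1 k hjk.2]
      exact hP j hjk.1 k hjk.2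
    · rw [show P' j k = 0 from if_neg hjk]
      exact analyticOnNhd_const
  -- The equations are continued for `P'`, analytic for all indices, then carried back to `P`. What
  -- remains is their validity on U ∩ Ω.
  refine (GenusFour.Equations.of_preconnected hV hne Set.inter_subset_right hc hP'
    (fun i j k m => GenusFour.analyticOnNhd_pderiv
      (GenusFour.analyticOnNhd_pderiv (hP' i j) k) m) (fun v hv => ?_) u hu).congr
    (fun j hj k hk => congrFun (hP'P j hj k hk) u)
    (fun i hi j hj k _ m _ => by rw [hP'P i hi j hj]; rfl)
  refine (hxy.equations hv.1).congr (fun j hj k hk => ?_) fun i hi j hj k _ m _ => ?_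
  · rw [hP'P j hj k hk, hPwp j hj k hk v hv]
  · rw [hP'P i hi j hj]
    -- Agreement on the open set U ∩ Ω passes to the second derivatives.
    exact GenusFour.pderiv_congr hV (GenusFour.pderiv_congr hV
      (fun z hz => (hPwp i hi j hj z hz).symm) k) m v hv
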